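/- Let $\mathbb{T}=\mathbb{R}\cup\{-\infty\}$ be the tropical semiring (addition is the maximum, multiplication is the usual addition), and let $UT_5(\mathbb{T})$ be the multiplicative semigroup of upper triangular $5\times 5$ matrices over $\mathbb{T}$ (with entries $-\infty$ below the diagonal). Let $\mathbb{P}_4$ be the plactic monoid of rank $4$, that is, the monoid generated by $1,2,3,4$ subject to the Knuth relations $yzx=yxz$ for $x<y\le z$ and $zxy=xzy$ for $x\le y<z$. A semigroup $S$ satisfies an identity $p=q$, where $p,q$ are non-empty words over an alphabet $\Sigma$, if every morphism $\Sigma^+\to S$ maps $p$ and $q$ to the same element; the variety generated by $S$ is the class of all semigroups satisfying every identity satisfied by $S$. For a word $t\in\{a,b\}^+$, write $t[ab,ba]$ for the word obtained from $t$ by substituting $a\mapsto ab$ and $b\mapsto ba$. Put $$u=ba^3b^3aba\cdot b\cdot ba^3b^3aba,\qquad v=ba^3b^3aba\cdot a\cdot ba^3b^3aba.$$ Then the identity $abuab[ab,ba]=abvab[ab,ba]$ (where the substitution is applied to the whole words $abuab$ and $abvab$) is satisfied by $\mathbb{P}_4$ but not by $UT_5(\mathbb{T})$. Moreover, the variety generated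 by $\mathbb{P}_4$ is strictly contained in the variety generated by $UT_5(\mathbb{T})$. -/

import Mathlib

universe u

/-- A semigroup `S` satisfies the identity `p = q`, where `p` and `q` are non-empty words over the
alphabet `X`, if every morphism from the free semigroup on `X` to `S` maps `p` and `q` to the same
element. -/
def SatisfiesIdentity (S : Type*) [Semigroup S] {X : Type*} (p q : FreeSemigroup X) : Prop :=
  ∀ φ : FreeSemigroup X →ₙ* S, φ p = φ q

/-- The variety generated by a semigroup `S`: the class of all semigroups that satisfy all the
semigroup identities (over all alphabets) satisfied by `S`. -/
def generatedVariety (S : Type*) [Semigroup S] : Set Semigrp.{u} :=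
  {T | ∀ (X : Type) (p q : FreeSemigroup X), SatisfiesIdentity S p q → SatisfiesIdentity T p q}

/-- The (max-plus) tropical semiring `ℝ ∪ {-∞}`. Addition is the minimum for the reversed order
of `ℝ` with a top element adjoined, that is, the maximum for the usual order, the adjoined element
being `-∞` (and the `0` of the semiring); multiplication is the usual addition. -/
abbrev MaxPlus : Type := Tropical (WithTop ℝᵒᵈ)

/-- The semigroup of upper triangular `n × n` matrices over the tropical semiring, with entries
`-∞` below the diagonal. -/
def UT (n : ℕ) : Subsemigroup (Matrix (Fin n) (Fin n) MaxPlus) where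
  carrier := {M | M.IsUpperTriangular}
  mul_mem' := fun hM hN => hM.mul hN

/-- The Knuth relations on words over an alphabet of `n` linearly ordered letters. -/
inductive KnuthRel (n : ℕ) : FreeMonoid (Fin n) → FreeMonoid (Fin n) → Prop
  | bca (a b c : Fin n) (hab : a < b) (hbc : b ≤ c) :
      KnuthRel n (.of b * .of c * .of a) (.of b * .of a * .of c)
  | cab (a b c : Fin n) (hab : a ≤ b) (hbc : b < c) :
      KnuthRel n (.of c * .of a * .of b) (.of a * .of c * .of b)

/-- The plactic monoid of rank `n`. -/
abbrev PlacticMonoid (n : ℕ) : Type := PresentedMonoid (KnuthRel n)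

/-- Non-empty words over the two-letter alphabet `{a, b}`. -/
abbrev Word : Type := FreeSemigroup (Fin 2)

namespace Word

/-- The letter `a`. -/
def a : Word := FreeSemigroup.of 0

/-- The letter `b`. -/
def b : Word := FreeSemigroup.of 1

/-- `w(x, y)`: the evaluation of the word `w` in `S` under `a ↦ x`, `b ↦ y`. When `S` is `Word`
itself this is the word written `w[x, y]`. -/
def eval {S : Type*} [Semigroup S] (w : Word) (x y : S) : S :=
  FreeSemigroup.lift ![x, y] w

/-- The word `b a³ b³ a b a`. -/
def w : Word := b * (a * a * a) * (b * b * b) * a * b * a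

/-- The word `u = b a³ b³ a b a · b · b a³ b³ a b a`. -/
def u : Word := w * b * w

/-- The word `v = b a³ b³ a b a · a · b a³ b³ a b a`. -/
def v : Word := w * a * w

/-- The word `a b u a b [ab, ba]`. -/
def lhs : Word := (a * b * u * a * b).eval (a * b) (b * a)

/-- The word `a b v a b [ab, ba]`. -/
def rhs : Word := (a * b * v * a * b).eval (a * b) (b * a)

end Word

/-!
The proof compares three tropical representations of the plactic monoid of rank four, indexed by
the subsets of the alphabet with one, two and three elements (`rowRep`, `pairRep`, `colRep`). All
their matrices are upper triangular, and the entry at `(I, J)` of the image of a word is the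
maximal weight of a path of subsets from `I` up to `J` while the word is read. Every element of
the plactic monoid is the reading of a semistandard tableau (`exists_tableau`, by row insertion).
The three representations and the numbers of occurrences of the letters determine the tableau,
since they give the number of letters `≤ x` in the first `k` rows for sufficiently many `x` and
`k` (`SameInvariants.eq`). In other words, the representations are jointly faithful.

*The variety of the plactic monoid is contained in that of `UT 5`.* The subsets of size one and of
size three form chains of length four. The subsets of size two are ordered componentwise, and this
poset has exactly two maximal chains, both of length five; they differ in the middle element only.
A path stays in one of these chains, so each of the three representations is controlled by upper
triangular matrices of size five, and an identity of `UT 5` holds in the plactic monoid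
(`sameInvariants_of_satisfiesIdentity`).

*The identity holds in the plactic monoid.* After the substitution one evaluates `abuab` and
`abvab` at `xy` and `yx`, whose images have the same diagonal. For triangular matrices with a
common diagonal `d`, an entry of a product along a word is the maximum, over the subwords
occurring in the word and over the positions of their occurrences, of an affine functional of
these positions, the functional depending only on the subword. The words `abuab` and `abvab` have
length `25` and differ in the middle letter. Thus it is enough that each occurrence of a subword
in one of them, if it involves the middle letter, is in the convex hull of the occurrences of the
same subword in the other one. For subwords of length at most three this is true. For length four
it is false, but such subwords are relevant only for the subsets of size two, where the diagonal
satisfies `d₀ + d₄ = d₁ + d₃`. The functional then depends on the positions only through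
`(p₁ + p₄, p₂, p₃)`, and the projected occurrences have the required property. Membership in the
convex hull is established by segments with integral end points, iterated over a few auxiliary
lattice points, and is checked by the kernel (`check3a` to `check4b`, `run_wordA_eq_run_wordB`).

*The identity fails in `UT 5`.* Two explicit matrices with entries in `ℕ ∪ {-∞}` give the values
`75` and `74` for the entry in the upper right corner of the two sides. As the identity separates
the two varieties, the inclusion is strict.
-/

namespace PlacticFour

open Tropical Matrix

/-! ### Representations of the plactic monoid on subsets of the letters -/

/-- The max-plus semiring `ℕ ∪ {-∞}`, in the same encoding as `MaxPlus`. Its equality can be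
decided by evaluation. -/
abbrev NatMaxPlus : Type := Tropical (WithTop ℕᵒᵈ)

/-- The real number `x` as an element of the max-plus semiring. -/
def fin (x : ℝ) : MaxPlus := trop ((OrderDual.toDual x : ℝᵒᵈ) : WithTop ℝᵒᵈ)

/-- The natural number `n` as an element of the max-plus semiring. -/
def nfin (n : ℕ) : NatMaxPlus := trop ((OrderDual.toDual n : ℕᵒᵈ) : WithTop ℕᵒᵈ)

/-- The image of the letter `x` in the representation on subsets with one element: the entry at
`(i, j)` for `i ≤ j` is `1` if `x` belongs to the interval from `i` to `j`, and `0` otherwise. The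
index `4` stands for no letter; it only pads the matrix to size five. -/
def rowGen (x : Fin 4) : Matrix (Fin 5) (Fin 5) NatMaxPlus := fun i j =>
  if i ≤ j then nfin (if i ≤ x.castSucc ∧ x.castSucc ≤ j then 1 else 0) else 0

/-- The image of the letter `x` in the representation on subsets with three elements. The index
`i < 4` stands for the complement of the letter `3 - i`, and the index `4` only pads the matrix to
size five. -/
def colGen (x : Fin 4) : Matrix (Fin 5) (Fin 5) NatMaxPlus := fun i j =>
  if i ≤ j then nfin (if i = j ∧ i = x.rev.castSucc then 0 else 1) else 0

/-- The smaller element of the `i`-th subset with two elements, in the lexicographic order `{0,1},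
{0,2}, {0,3}, {1,2}, {1,3}, {2,3}`. -/
def pairFst : Fin 6 → Fin 4 := ![0, 0, 0, 1, 1, 2]

/-- The larger element of the `i`-th subset with two elements. -/
def pairSnd : Fin 6 → Fin 4 := ![1, 2, 3, 2, 3, 3]

/-- The image of the letter `x` in the representation on subsets with two elements, ordered
componentwise. The entry at `(i, j)` for `i ≤ j` is `1` if `x` belongs to one of the two intervals
from the elements of `i` to the corresponding elements of `j`, and `0` otherwise. -/
def pairGen (x : Fin 4) : Matrix (Fin 6) (Fin 6) NatMaxPlus := fun i j =>
  if pairFst i ≤ pairFst j ∧ pairSnd i ≤ pairSnd j then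
    nfin (if (pairFst i ≤ x ∧ x ≤ pairFst j) ∨ (pairSnd i ≤ x ∧ x ≤ pairSnd j) then 1 else 0)
  else 0

/-- The matrices `rowGen x` satisfy the Knuth relations `bca = bac`, and likewise below for the
other relations and representations. -/
theorem row_b : ∀ a b c : Fin 4, a < b → b ≤ c →
    ∀ i j, (rowGen b * rowGen c * rowGen a) i j = (rowGen b * rowGen a * rowGen c) i j := by
  decide +kernel

theorem row_c : ∀ a b c : Fin 4, a ≤ b → b < c →
    ∀ i j, (rowGen c * rowGen a * rowGen b) i j = (rowGen a * rowGen c * rowGen b) i j := by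
  decide +kernel

theorem col_b : ∀ a b c : Fin 4, a < b → b ≤ c →
    ∀ i j, (colGen b * colGen c * colGen a) i j = (colGen b * colGen a * colGen c) i j := by
  decide +kernel

theorem col_c : ∀ a b c : Fin 4, a ≤ b → b < c →
    ∀ i j, (colGen c * colGen a * colGen b) i j = (colGen a * colGen c * colGen b) i j := by
  decide +kernel

theorem pair_b : ∀ a b c : Fin 4, a < b → b ≤ c →
    ∀ i j, (pairGen b * pairGen c * pairGen a) i j = (pairGen b * pairGen a * pairGen c) i j := by
  decide +kernel

theorem pair_c : ∀ a b c : Fin 4, a ≤ b → b < c →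
    ∀ i j, (pairGen c * pairGen a * pairGen b) i j = (pairGen a * pairGen c * pairGen b) i j := by
  decide +kernel

/-! ### The finite search over occurrences of subwords -/

/-- A lattice point: the positions `(p₁, p₂, p₃)` of an occurrence of a subword of length three,
or the projection `(p₁ + p₄, p₂, p₃)` of an occurrence of a subword of length four. -/
abbrev Pt : Type := ℕ × ℕ × ℕ

/-- The `n`-th binary digit of `m`. This and the following functions are written with the
operations of `Nat` that the kernel evaluates natively. -/
def bit (m n : ℕ) : Bool := Nat.beq (Nat.mod (Nat.shiftRight m n) 2) 1

/-- The word `abvab` as a binary number: the digit `n` is `1` if and only if the letter at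
position `n` is `b`. -/
def wordA : ℕ := 19801542

/-- The word `abuab` as a binary number; it differs from `wordA` in the digit `12`. -/
def wordB : ℕ := 19805638

/-- The set of the positions `n < 25` of the letter `x` in the word given by `mask`, where `true`
stands for `b` and `33554431 = 2 ^ 25 - 1`. -/
def posMask (mask : ℕ) (x : Bool) : ℕ := cond x mask (Nat.sub 33554431 mask)

/-- Whether `(a, b, c)` is an occurrence of the subword `xyz`. -/
def occ3 (mask : ℕ) (x y z : Bool) (a b c : ℕ) : Bool :=
  Nat.blt a b && Nat.blt b c && bit (posMask mask z) c && bit (posMask mask y) b &&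
    bit (posMask mask x) a

/-- The number `m` with its digits below `n` replaced by `0`. -/
def clearLow (m n : ℕ) : ℕ := Nat.shiftLeft (Nat.shiftRight m n) n

/-- Whether `(a, b, c)` is the projection of an occurrence of the subword `xyzt`, that is, whether
there are positions `i < b < c < j` with `i + j = a`. The number `rev` encodes the reversed word.
The possible `i` become the digits `24 - i + a` of one number and the possible `j` the digits
`24 + j` of another, so that a sum equal to `a` is a common digit. -/
def occ4 (mask rev : ℕ) (x y z t : Bool) (a b c : ℕ) : Bool :=
  Nat.blt b c && bit (posMask mask y) b && bit (posMask mask z) c &&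
    Nat.blt 0 (Nat.land (Nat.shiftLeft (clearLow (posMask rev x) (Nat.sub 25 b)) a)
      (Nat.shiftLeft (clearLow (posMask mask t) (Nat.succ c)) 24))

/-- The sign of a coordinate of a direction. -/
inductive Dir | pos | zero | neg

/-- The coordinate reached from `a` after `s` unit moves. -/
def Dir.fwd : Dir → ℕ → ℕ → ℕ
  | pos, a, s => Nat.add a s
  | zero, a, _ => a
  | neg, a, s => Nat.sub a s

/-- The coordinate reached from `a` after `t` unit moves in the opposite direction. -/
def Dir.bwd : Dir → ℕ → ℕ → ℕ
  | neg, a, s => Nat.add a s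
  | zero, a, _ => a
  | pos, a, s => Nat.sub a s

/-- No subtraction in `Dir.fwd` and `Dir.bwd` is truncated. -/
def Dir.ok : Dir → ℕ → ℕ → ℕ → Bool
  | pos, a, _, t => Nat.ble t a
  | zero, _, _, _ => true
  | neg, a, s, _ => Nat.ble s a

open Dir in
/-- The directions in which segments through a given point are sought. -/
def dirs : List (Dir × Dir × Dir) :=
  [(zero, zero, pos), (zero, pos, zero), (pos, zero, zero), (zero, pos, pos), (pos, pos, zero),
   (pos, zero, pos), (pos, pos, pos), (pos, zero, neg), (pos, neg, zero),
    (zero, pos, neg), (pos, neg, neg), (pos, neg, pos), (pos, pos, neg)]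

/-- The admissible distances of the end points of a segment from the given point. -/
def steps : List ℕ := [1, 2, 3, 4, 5, 6, 7, 8, 9, 10, 11, 12]

/-- Whether `(a, b, c)` lies inside a segment with end points in `O` and direction `(u, v, w)`. In
the forward direction the nearest point of `O` suffices. -/
def onSegmentDir (O : ℕ → ℕ → ℕ → Bool) (a b c : ℕ) (u v w : Dir) : Bool :=
  match steps.find? fun s => O (u.fwd a s) (v.fwd b s) (w.fwd c s) with
  | none => false
  | some s => steps.any fun t => O (u.bwd a t) (v.bwd b t) (w.bwd c t) &&
      u.ok a s t && v.ok b s t && w.ok c s t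

open Dir in
/-- Whether `(a, b, c)` lies inside a segment with end points in `O` and one of the directions in
`dirs`. For speed, the first direction tried moves a single coordinate: `b` or `c` if it is the
middle position `12`, and `a` otherwise. -/
def onSegment (O : ℕ → ℕ → ℕ → Bool) (a b c : ℕ) : Bool :=
  cond (Nat.beq b 12) (onSegmentDir O a b c zero pos zero) (cond (Nat.beq c 12)
    (onSegmentDir O a b c zero zero pos) (onSegmentDir O a b c pos zero zero)) ||
  dirs.any fun d => onSegmentDir O a b c d.1 d.2.1 d.2.2

/-- Whether `(a, b, c)` is one of the points of the list `H`. -/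
def isAmong (H : List Pt) (a b c : ℕ) : Bool :=
  H.any fun h => Nat.beq h.1 a && Nat.beq h.2.1 b && Nat.beq h.2.2 c

/-- Each point of the list lies inside a segment whose end points are in `O` or occur later in the
list. -/
def hintsValid (O : ℕ → ℕ → ℕ → Bool) : List Pt → Bool
  | [] => true
  | h :: H => hintsValid O H && onSegment (fun a b c => O a b c || isAmong H a b c) h.1 h.2.1 h.2.2

/-- Auxiliary points for subwords of length three. The first argument is the middle letter of the
word whose occurrences are to be covered, the others are the letters of the subword. -/
def hints3 : Bool → Bool → Bool → Bool → List Pt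
  | false, false, false, false => [(13,14,15),(12,13,14),(9,10,11),(4,8,9),(3,9,10)]
  | false, false, false, true => [(9,11,12)]
  | false, true, false, false => [(7,10,11)]
  | true, false, true, true => [(12,13,16)]
  | true, false, true, false => [(12,13,15)]
  | true, true, true, true => [(14,15,17),(10,11,19),(10,11,12)]
  | true, true, true, false => [(11,13,14)]
  | _, _, _, _ => []

/-- The word `wordA` read backwards. -/
def revA : ℕ := 13060329

/-- The word `wordB` read backwards. -/
def revB : ℕ := 13064425

/-- Auxiliary points for subwords of length four, with the arguments as in `hints3`. -/
def hints4 : Bool → Bool → Bool → Bool → Bool → List Pt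
  | false, false, true, false, false => [(36, 14, 15), (11, 7, 10)]
  | false, false, false, false, false => [(12, 9, 10), (9, 6, 8), (35, 13, 14), (34, 13, 14),
      (17, 14, 15), (16, 10, 15), (15, 13, 14), (15, 7, 8), (12, 10, 11), (12, 3, 11), (9, 7, 8),
      (9, 3, 8)]
  | false, false, false, true, false => [(15, 13, 14)]
  | false, false, false, false, true => [(37, 14, 15), (36, 13, 14), (34, 11, 12), (28, 11, 12),
      (19, 6, 12), (14, 11, 12), (11, 9, 10)]
  | false, false, false, true, true => [(33, 11, 12)]
  | false, true, true, false, false => [(11, 8, 9), (11, 7, 9)]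
  | false, true, false, false, false => [(27, 9, 10), (18, 14, 16), (16, 13, 14), (13, 10, 11),
      (13, 9, 10), (13, 3, 11)]
  | false, true, false, false, true => [(25, 10, 11), (13, 10, 11)]
  | true, false, true, true, true => [(36, 13, 18), (16, 12, 14), (12, 10, 11)]
  | true, false, true, false, true => [(36, 13, 15)]
  | true, false, true, true, false => [(35, 13, 18), (13, 10, 11)]
  | true, false, false, true, false => [(12, 9, 10)]
  | true, false, true, false, false => [(35, 13, 16), (35, 13, 14)]
  | true, true, true, false, true => [(34, 11, 14)]
  | true, true, true, true, true => [(38, 15, 17), (37, 14, 19), (34, 12, 21), (34, 12, 14),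
      (34, 11, 12), (13, 10, 11)]
  | true, true, true, true, false => [(37, 15, 17), (36, 14, 19), (34, 13, 19), (34, 13, 16),
      (32, 11, 12)]
  | true, true, true, false, false => [(34, 13, 16)]
  | _, _, _, _, _ => []

/-- Each occurrence of `xyz` in the word `mask` that involves the middle position lies inside a
segment with end points among the occurrences of `xyz` in the word `mask'` and the auxiliary
points `H`. -/
def check3 (mask mask' : ℕ) (x y z : Bool) (H : List Pt) : Bool :=
  hintsValid (occ3 mask' x y z) H &&
  (List.range 25).all fun p₃ => !bit (posMask mask z) p₃ ||
  (List.range p₃).all fun p₂ => !bit (posMask mask y) p₂ ||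
  (List.range p₂).all fun p₁ => !bit (posMask mask x) p₁ ||
    !(Nat.beq p₁ 12 || Nat.beq p₂ 12 || Nat.beq p₃ 12) ||
      onSegment (occ3 mask' x y z) p₁ p₂ p₃ ||
      onSegment (fun a b c => occ3 mask' x y z a b c || isAmong H a b c) p₁ p₂ p₃

/-- Each occurrence of `xyzt` in the word `mask` that involves the middle position projects to the
projection of an occurrence in the word `mask'`, or into a segment whose end points are such
projections or auxiliary points in `H`. -/
def check4 (mask mask' rev' : ℕ) (x y z t : Bool) (H : List Pt) : Bool :=
  hintsValid (occ4 mask' rev' x y z t) H &&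
  (List.range 25).all fun p₄ => !bit (posMask mask t) p₄ ||
  (List.range p₄).all fun p₃ => !bit (posMask mask z) p₃ ||
  (List.range p₃).all fun p₂ => !bit (posMask mask y) p₂ ||
  (List.range p₂).all fun p₁ => !bit (posMask mask x) p₁ ||
    !(Nat.beq p₁ 12 || Nat.beq p₂ 12 || Nat.beq p₃ 12 || Nat.beq p₄ 12) ||
     (occ4 mask' rev' x y z t (Nat.add p₁ p₄) p₂ p₃ ||
      onSegment (occ4 mask' rev' x y z t) (Nat.add p₁ p₄) p₂ p₃ ||
      onSegment (fun a b c => occ4 mask' rev' x y z t a b c ||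
        isAmong H a b c) (Nat.add p₁ p₄) p₂ p₃)

theorem check3a : ∀ x y z, check3 wordA wordB x y z (hints3 false x y z) = true := by
  decide +kernel

theorem check3b : ∀ x y z, check3 wordB wordA x y z (hints3 true x y z) = true := by
  decide +kernel

theorem check4a : ∀ x y z t, check4 wordA wordB revB x y z t (hints4 false x y z t) = true := by
  decide +kernel

theorem check4b : ∀ x y z t, check4 wordB wordA revA x y z t (hints4 true x y z t) = true := by
  decide +kernel

/-! ### Arithmetic of the max-plus semiring -/

theorem fin_mul (x y : ℝ) : fin x * fin y = fin (x + y) := rfl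

theorem fin_zero : fin 0 = 1 := rfl

theorem fin_le {x y : ℝ} : fin x ≤ fin y ↔ y ≤ x := by
  unfold fin
  rw [← untrop_le_iff]
  simp

theorem fin_add (x y : ℝ) : fin x + fin y = fin (max x y) := by
  rcases le_total x y with h | h
  · rw [max_eq_right h, add_eq_right (fin_le.2 h)]
  · rw [max_eq_left h, add_eq_left (fin_le.2 h)]

theorem fin_inj {x y : ℝ} : fin x = fin y ↔ x = y := by
  refine ⟨fun h => ?_, fun h => by rw [h]⟩
  exact le_antisymm (fin_le.1 h.ge) (fin_le.1 h.le)

theorem eq_zero_or_fin (z : MaxPlus) : z = 0 ∨ ∃ x, z = fin x := by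
  induction z using Tropical.tropRec with
  | h z =>
    cases z using WithTop.recTopCoe with
    | top => exact Or.inl rfl
    | coe x => exact Or.inr ⟨OrderDual.ofDual x, rfl⟩

theorem add_le_left (x y : MaxPlus) : x + y ≤ x := by
  rw [← untrop_le_iff, untrop_add]; exact min_le_left _ _

theorem sum_le {ι : Type*} [Fintype ι] (f : ι → MaxPlus) (i : ι) : ∑ k, f k ≤ f i := by
  classical
  rw [← Finset.add_sum_erase _ _ (Finset.mem_univ i)]
  exact add_le_left _ _

/-- A maximum over a finite nonempty set is attained. -/
theorem exists_sum_eq {ι : Type*} [Fintype ι] [Nonempty ι] (f : ι → MaxPlus) :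
    ∃ i, ∑ k, f k = f i := by
  obtain ⟨i, -, hi⟩ := Finset.exists_mem_eq_inf (Finset.univ : Finset ι) Finset.univ_nonempty
    (untrop ∘ f)
  refine ⟨i, untrop_injective ?_⟩
  rw [Finset.untrop_sum', hi]; rfl

/-! ### Soundness of the search -/

/-- `P` holds at a lattice point inside a segment if it holds at the end points. The point divides
the segment in the ratio `s : t`. -/
def SegmentClosed (P : ℕ → ℕ → ℕ → Prop) : Prop :=
  ∀ a b c a₁ b₁ c₁ a₂ b₂ c₂ s t : ℕ, 0 < s → 0 < t →
    t * a₁ + s * a₂ = (s + t) * a → t * b₁ + s * b₂ = (s + t) * b →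
    t * c₁ + s * c₂ = (s + t) * c → P a₁ b₁ c₁ → P a₂ b₂ c₂ → P a b c

theorem Dir.between {u : Dir} {a s t : ℕ} (h : u.ok a s t = true) :
    t * u.fwd a s + s * u.bwd a t = (s + t) * a := by
  cases u with
  | pos =>
    obtain ⟨k, rfl⟩ := Nat.exists_eq_add_of_le (Nat.le_of_ble_eq_true h)
    change t * (t + k + s) + s * (t + k - t) = _
    rw [Nat.add_sub_cancel_left]; ring
  | zero => change t * a + s * a = _; ring
  | neg =>
    obtain ⟨k, rfl⟩ := Nat.exists_eq_add_of_le (Nat.le_of_ble_eq_true h)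
    change t * (s + k - s) + s * (s + k + t) = _
    rw [Nat.add_sub_cancel_left]; ring

theorem pos_of_mem_steps {s : ℕ} (h : s ∈ steps) : 0 < s := by
  revert s; decide

theorem of_onSegmentDir {O : ℕ → ℕ → ℕ → Bool} {P : ℕ → ℕ → ℕ → Prop} (hP : SegmentClosed P)
    (hO : ∀ a b c, O a b c = true → P a b c) {a b c : ℕ} {u v w : Dir}
    (h : onSegmentDir O a b c u v w = true) : P a b c := by
  unfold onSegmentDir at h
  split at h
  · cases h
  · rename_i s hs
    have hfwd : O (u.fwd a s) (v.fwd b s) (w.fwd c s) = true := by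
      simpa using List.find?_some hs
    obtain ⟨t, ht, h⟩ := List.any_eq_true.1 h
    simp only [Bool.and_eq_true] at h
    obtain ⟨⟨⟨h, hu⟩, hv⟩, hw⟩ := h
    exact hP _ _ _ _ _ _ _ _ _ s t (pos_of_mem_steps (List.mem_of_find?_eq_some hs))
      (pos_of_mem_steps ht) (Dir.between hu) (Dir.between hv) (Dir.between hw)
      (hO _ _ _ hfwd) (hO _ _ _ h)

theorem of_onSegment {O : ℕ → ℕ → ℕ → Bool} {P : ℕ → ℕ → ℕ → Prop} (hP : SegmentClosed P)
    (hO : ∀ a b c, O a b c = true → P a b c) {a b c : ℕ} (h : onSegment O a b c = true) :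
    P a b c := by
  unfold onSegment at h
  rcases Bool.or_eq_true_iff.1 h with h | h
  · cases hb : Nat.beq b 12 <;> cases hc : Nat.beq c 12 <;> rw [hb, hc] at h <;>
      exact of_onSegmentDir hP hO h
  · obtain ⟨d, -, h⟩ := List.any_eq_true.1 h
    exact of_onSegmentDir hP hO h

theorem of_isAmong {H : List Pt} {P : ℕ → ℕ → ℕ → Prop} (hH : ∀ h ∈ H, P h.1 h.2.1 h.2.2)
    {a b c : ℕ} (h : isAmong H a b c = true) : P a b c := by
  obtain ⟨p, hp, h⟩ := List.any_eq_true.1 h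
  simp only [Bool.and_eq_true] at h
  obtain ⟨⟨ha, hb⟩, hc⟩ := h
  rw [← Nat.eq_of_beq_eq_true ha, ← Nat.eq_of_beq_eq_true hb, ← Nat.eq_of_beq_eq_true hc]
  exact hH p hp

theorem of_hintsValid {O : ℕ → ℕ → ℕ → Bool} {P : ℕ → ℕ → ℕ → Prop} (hP : SegmentClosed P)
    (hO : ∀ a b c, O a b c = true → P a b c) {H : List Pt} (h : hintsValid O H = true) :
    ∀ h ∈ H, P h.1 h.2.1 h.2.2 := by
  induction H with
  | nil => simp
  | cons p H ih =>
    obtain ⟨h₁, h₂⟩ := Bool.and_eq_true_iff.1 h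
    refine List.forall_mem_cons.2 ⟨of_onSegment hP (fun a b c h => ?_) h₂, ih h₁⟩
    rcases Bool.or_eq_true_iff.1 h with h | h
    · exact hO _ _ _ h
    · exact of_isAmong (ih h₁) h

theorem of_onSegment_hints {O : ℕ → ℕ → ℕ → Bool} {P : ℕ → ℕ → ℕ → Prop} (hP : SegmentClosed P)
    (hO : ∀ a b c, O a b c = true → P a b c) {H : List Pt} (hH : hintsValid O H = true) {a b c : ℕ}
    (h : onSegment (fun a b c => O a b c || isAmong H a b c) a b c = true) : P a b c := by
  refine of_onSegment hP (fun a b c h => ?_) h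
  rcases Bool.or_eq_true_iff.1 h with h | h
  · exact hO _ _ _ h
  · exact of_isAmong (of_hintsValid hP hO hH) h

theorem bit_eq_testBit (m n : ℕ) : bit m n = m.testBit n := by
  rw [Nat.testBit_eq_decide_div_mod_eq, ← Nat.shiftRight_eq_div_pow]
  unfold bit
  by_cases h : m >>> n % 2 = 1
  · rw [decide_eq_true h]
    exact Nat.beq_eq ▸ h
  · rw [decide_eq_false h]
    exact Bool.eq_false_iff.2 fun h' => h (Nat.eq_of_beq_eq_true h')

theorem lt_of_bit {m n : ℕ} (hm : m < 2 ^ 25) (h : bit m n = true) : n < 25 := by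
  by_contra hn
  rw [bit_eq_testBit, Nat.testBit_lt_two_pow
    (hm.trans_le (Nat.pow_le_pow_right (by norm_num) (not_lt.1 hn)))] at h
  cases h

/-- The number `mask` encodes a word of length `25`, and `rev` the reversed word. -/
def IsWordMask (mask rev : ℕ) : Prop :=
  (∀ x, posMask mask x < 2 ^ 25) ∧ (∀ x, posMask rev x < 2 ^ 25) ∧
  (∀ n < 25, ∀ x, bit (posMask mask x) n = true ↔ bit mask n = x) ∧
    ∀ n < 25, ∀ x, bit (posMask rev x) n = true ↔ bit mask (24 - n) = x

theorem isWordMask_A : IsWordMask wordA revA := by unfold IsWordMask; decide +kernel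

theorem isWordMask_B : IsWordMask wordB revB := by unfold IsWordMask; decide +kernel

theorem bit_wordA_eq : ∀ n < 25, n ≠ 12 → bit wordA n = bit wordB n := by decide +kernel

theorem letters_of_occ3 {mask rev : ℕ} (hm : IsWordMask mask rev) {x y z : Bool} {a b c : ℕ}
    (h : occ3 mask x y z a b c = true) :
    a < b ∧ b < c ∧ c < 25 ∧ bit mask a = x ∧ bit mask b = y ∧ bit mask c = z := by
  unfold occ3 at h
  simp only [Bool.and_eq_true] at h
  obtain ⟨⟨⟨⟨hab, hbc⟩, hz⟩, hy⟩, hx⟩ := h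
  have hab : a < b := Nat.le_of_ble_eq_true hab
  have hbc : b < c := Nat.le_of_ble_eq_true hbc
  have hc := lt_of_bit (hm.1 z) hz
  exact ⟨hab, hbc, hc, (hm.2.2.1 a (by omega) x).1 hx, (hm.2.2.1 b (by omega) y).1 hy,
    (hm.2.2.1 c hc z).1 hz⟩

theorem letters_of_occ4 {mask rev : ℕ} (hm : IsWordMask mask rev) {x y z t : Bool} {a b c : ℕ}
    (h : occ4 mask rev x y z t a b c = true) :
    ∃ i j, i + j = a ∧ i < b ∧ b < c ∧ c < j ∧ j < 25 ∧
      bit mask i = x ∧ bit mask b = y ∧ bit mask c = z ∧ bit mask j = t := by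
  unfold occ4 at h
  simp only [Bool.and_eq_true] at h
  obtain ⟨⟨⟨hbc, hy⟩, hz⟩, h⟩ := h
  have hbc : b < c := Nat.le_of_ble_eq_true hbc
  have hc := lt_of_bit (hm.1 z) hz
  have h0 := Nat.le_of_ble_eq_true h
  obtain ⟨k, hk⟩ := Nat.exists_testBit_of_ne_zero (Nat.pos_iff_ne_zero.1 h0)
  change (((posMask rev x >>> (25 - b)) <<< (25 - b)) <<< a &&&
    ((posMask mask t >>> (c + 1)) <<< (c + 1)) <<< 24).testBit k = true at hk
  simp only [Nat.testBit_land, Nat.testBit_shiftLeft, Nat.testBit_shiftRight, Bool.and_eq_true,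
    decide_eq_true_eq] at hk
  simp only [← bit_eq_testBit] at hk
  obtain ⟨⟨hka, hkb, hx⟩, hk24, hkc, ht⟩ := hk
  rw [Nat.add_sub_cancel' hkb] at hx
  rw [Nat.add_sub_cancel' hkc] at ht
  have hx' := lt_of_bit (hm.2.1 x) hx
  have ht' := lt_of_bit (hm.1 t) ht
  refine ⟨24 - (k - a), k - 24, by omega, by omega, hbc, by omega, ht',
    (hm.2.2.2 _ hx' x).1 hx, (hm.2.2.1 b (by omega) y).1 hy, (hm.2.2.1 c hc z).1 hz,
    (hm.2.2.1 _ ht' t).1 ht⟩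

/-- A property closed under segments that holds at the occurrences of `xyz` in one of the words
holds at the occurrences in the other. Occurrences that avoid the position `12` are common to both
words. -/
theorem of_check3 {mask rev mask' rev' : ℕ} (hm : IsWordMask mask rev) (hm' : IsWordMask mask' rev')
    (heq : ∀ n < 25, n ≠ 12 → bit mask n = bit mask' n) {H : Bool → Bool → Bool → List Pt}
    (h : ∀ x y z, check3 mask mask' x y z (H x y z) = true)
    {P : ℕ → ℕ → ℕ → Prop} (hP : SegmentClosed P) {x y z : Bool}
    (hO : ∀ a b c, a < b → b < c → c < 25 → bit mask' a = x → bit mask' b = y → bit mask' c = z →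
      P a b c)
    {a b c : ℕ} (hab : a < b) (hbc : b < c) (hc : c < 25) (hx : bit mask a = x)
      (hy : bit mask b = y)
    (hz : bit mask c = z) : P a b c := by
  have hO' : ∀ a b c, occ3 mask' x y z a b c = true → P a b c := fun a b c h =>
    have h := letters_of_occ3 hm' h
    hO a b c h.1 h.2.1 h.2.2.1 h.2.2.2.1 h.2.2.2.2.1 h.2.2.2.2.2
  by_cases hmid : a = 12 ∨ b = 12 ∨ c = 12
  · have h := h x y z
    unfold check3 at h
    obtain ⟨hH, h⟩ := Bool.and_eq_true_iff.1 h
    have h := List.all_eq_true.1 h c (List.mem_range.2 hc)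
    rw [(hm.2.2.1 c hc z).2 hz, Bool.not_true, Bool.false_or] at h
    have h := List.all_eq_true.1 h b (List.mem_range.2 hbc)
    rw [(hm.2.2.1 b (by omega) y).2 hy, Bool.not_true, Bool.false_or] at h
    have h := List.all_eq_true.1 h a (List.mem_range.2 hab)
    rw [(hm.2.2.1 a (by omega) x).2 hx, Bool.not_true, Bool.false_or] at h
    have hmid' : (Nat.beq a 12 || Nat.beq b 12 || Nat.beq c 12) = true := by
      simp only [Bool.or_eq_true, Nat.beq_eq]; tauto
    rw [hmid', Bool.not_true, Bool.false_or] at h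
    rcases Bool.or_eq_true_iff.1 h with h | h
    · exact of_onSegment hP hO' h
    · exact of_onSegment_hints hP hO' hH h
  · push Not at hmid
    exact hO a b c hab hbc hc (heq a (by omega) hmid.1 ▸ hx) (heq b (by omega) hmid.2.1 ▸ hy)
      (heq c hc hmid.2.2 ▸ hz)

/-- The analogue of `of_check3` for the projections `(p₁ + p₄, p₂, p₃)` of occurrences of a
subword of length four. -/
theorem of_check4 {mask rev mask' rev' : ℕ} (hm : IsWordMask mask rev) (hm' : IsWordMask mask' rev')
    (heq : ∀ n < 25, n ≠ 12 → bit mask n = bit mask' n) {H : Bool → Bool → Bool → Bool → List Pt}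
    (h : ∀ x y z t, check4 mask mask' rev' x y z t (H x y z t) = true)
    {P : ℕ → ℕ → ℕ → Prop} (hP : SegmentClosed P) {x y z t : Bool}
    (hO : ∀ i a b j, i < a → a < b → b < j → j < 25 → bit mask' i = x → bit mask' a = y →
      bit mask' b = z → bit mask' j = t → P (i + j) a b)
    {i a b j : ℕ} (hia : i < a) (hab : a < b) (hbj : b < j) (hj : j < 25)
    (hx : bit mask i = x) (hy : bit mask a = y) (hz : bit mask b = z) (ht : bit mask j = t) :
    P (i + j) a b := by
  have hO' : ∀ a b c, occ4 mask' rev' x y z t a b c = true → P a b c := fun a b c h => by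
    obtain ⟨i, j, rfl, h₁, h₂, h₃, h₄, h₅, h₆, h₇, h₈⟩ := letters_of_occ4 hm' h
    exact hO i b c j h₁ h₂ h₃ h₄ h₅ h₆ h₇ h₈
  by_cases hmid : i = 12 ∨ a = 12 ∨ b = 12 ∨ j = 12
  · have h := h x y z t
    unfold check4 at h
    obtain ⟨hH, h⟩ := Bool.and_eq_true_iff.1 h
    have h := List.all_eq_true.1 h j (List.mem_range.2 hj)
    rw [(hm.2.2.1 j hj t).2 ht, Bool.not_true, Bool.false_or] at h
    have h := List.all_eq_true.1 h b (List.mem_range.2 hbj)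
    rw [(hm.2.2.1 b (by omega) z).2 hz, Bool.not_true, Bool.false_or] at h
    have h := List.all_eq_true.1 h a (List.mem_range.2 hab)
    rw [(hm.2.2.1 a (by omega) y).2 hy, Bool.not_true, Bool.false_or] at h
    have h := List.all_eq_true.1 h i (List.mem_range.2 hia)
    rw [(hm.2.2.1 i (by omega) x).2 hx, Bool.not_true, Bool.false_or] at h
    have hmid' : (Nat.beq i 12 || Nat.beq a 12 || Nat.beq b 12 || Nat.beq j 12) = true := by
      simp only [Bool.or_eq_true, Nat.beq_eq]; tauto
    rw [hmid', Bool.not_true, Bool.false_or] at h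
    rcases Bool.or_eq_true_iff.1 h with h | h
    · rcases Bool.or_eq_true_iff.1 h with h | h
      · exact hO' _ _ _ h
      · exact of_onSegment hP hO' h
    · exact of_onSegment_hints hP hO' hH h
  · push Not at hmid
    exact hO i a b j hia hab hbj hj (heq i (by omega) hmid.1 ▸ hx)
      (heq a (by omega) hmid.2.1 ▸ hy) (heq b (by omega) hmid.2.2.1 ▸ hz)
      (heq j hj hmid.2.2.2 ▸ ht)

/-- The order on `MaxPlus` is reversed, so the condition reads: an affine functional is at most `z`.
It therefore defines a half-space. -/
theorem segmentClosed_le (z K : MaxPlus) (k α β γ : ℝ) :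
    SegmentClosed fun a b c => z ≤ K * fin (k + α * a + β * b + γ * c) := by
  intro a b c a₁ b₁ c₁ a₂ b₂ c₂ s t hs ht ha hb hc h₁ h₂
  rcases eq_zero_or_fin K with rfl | ⟨κ, rfl⟩
  · simp [le_zero]
  rw [fin_mul] at h₁ h₂ ⊢
  rcases eq_zero_or_fin z with rfl | ⟨ζ, rfl⟩
  · have h₀ : fin (κ + (k + α * a₁ + β * b₁ + γ * c₁)) = 0 := le_antisymm (le_zero _) h₁
    exact absurd h₀ (trop_coe_ne_zero _)
  rw [fin_le] at h₁ h₂ ⊢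
  have ha' : (t * a₁ + s * a₂ : ℝ) = (s + t) * a := by exact_mod_cast ha
  have hb' : (t * b₁ + s * b₂ : ℝ) = (s + t) * b := by exact_mod_cast hb
  have hc' : (t * c₁ + s * c₂ : ℝ) = (s + t) * c := by exact_mod_cast hc
  have hs' : (0 : ℝ) < s := by exact_mod_cast hs
  have ht' : (0 : ℝ) < t := by exact_mod_cast ht
  have e₁ := mul_le_mul_of_nonneg_left h₁ ht'.le
  have e₂ := mul_le_mul_of_nonneg_left h₂ hs'.le
  refine le_of_mul_le_mul_left ?_ (add_pos hs' ht')
  have : (s + t : ℝ) * (κ + (k + α * a + β * b + γ * c)) =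
      t * (κ + (k + α * a₁ + β * b₁ + γ * c₁)) + s * (κ + (k + α * a₂ + β * b₂ + γ * c₂)) := by
    linear_combination -α * ha' - β * hb' - γ * hc'
  linarith

/-! ### Products of triangular tropical matrices along a word -/

section Run

variable {k : ℕ} (M : Bool → Matrix (Fin k) (Fin k) MaxPlus) (v : Fin k → MaxPlus) (s : ℕ → Bool)

/-- The row vector `v * M (s 0) * ⋯ * M (s (n - 1))`. -/
noncomputable def run : ℕ → Fin k → MaxPlus
  | 0 => v
  | n + 1 => run n ᵥ* M (s n)

/-- The weight of a path of states that reaches `j` at time `n`. The list gives its jumps, the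
last one first: `(p, i)` means that the letter at position `p` is used to leave the state `i` for
the next state. All other letters are spent at a diagonal entry `d`. -/
noncomputable def pathWeight (d : Fin k → ℝ) : ℕ → Fin k → List (ℕ × Fin k) → MaxPlus
  | n, j, [] => v j * fin (n * d j)
  | n, j, (p, i) :: J => pathWeight d p i J * M (s p) i j * fin ((n - 1 - p) * d j)

/-- The list describes a path that reaches `j` at time `n`: the positions of the jumps decrease
along the list, and each jump leads from a state to an `r`-related one. -/
def IsPath (r : Fin k → Fin k → Prop) : ℕ → Fin k → List (ℕ × Fin k) → Prop
  | _, _, [] => True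
  | n, j, (p, i) :: J => p < n ∧ r i j ∧ IsPath r p i J

variable {M v s}

theorem run_add_le {d : Fin k → ℝ} (hd : ∀ x i, M x i i = fin (d i)) (p q : ℕ) (j : Fin k) :
    run M v s (p + q) j ≤ run M v s p j * fin (q * d j) := by
  induction q with
  | zero => simp [fin_zero]
  | succ q ih =>
    calc run M v s (p + q + 1) j ≤ run M v s (p + q) j * M (s (p + q)) j j :=
          sum_le (fun i => run M v s (p + q) i * M (s (p + q)) i j) j
      _ ≤ run M v s p j * fin (q * d j) * fin (d j) := by
          rw [hd]; exact mul_le_mul_left ih _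
      _ = _ := by rw [mul_assoc, fin_mul]; push_cast; ring_nf

/-- In the usual order: no path has larger weight than the corresponding entry of the product. -/
theorem run_le_pathWeight {d : Fin k → ℝ} (hd : ∀ x i, M x i i = fin (d i))
    {r : Fin k → Fin k → Prop} (J : List (ℕ × Fin k)) {n : ℕ} {j : Fin k} (hJ : IsPath r n j J) :
    run M v s n j ≤ pathWeight M v s d n j J := by
  induction J generalizing n j with
  | nil => simpa [pathWeight, run] using run_add_le (v := v) (s := s) hd 0 n j
  | cons e J ih =>
    obtain ⟨p, i⟩ := e
    obtain ⟨hp, -, hJ⟩ := hJ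
    obtain ⟨q, rfl⟩ := Nat.exists_eq_add_of_lt hp
    have h : ((p + q + 1 : ℕ) - 1 - p : ℝ) = q := by push_cast; ring
    calc run M v s (p + q + 1) j = run M v s (p + 1 + q) j := by rw [Nat.add_right_comm]
      _ ≤ run M v s (p + 1) j * fin (q * d j) := run_add_le hd _ _ _
      _ ≤ run M v s p i * M (s p) i j * fin (q * d j) :=
          mul_le_mul_left (sum_le (fun i => run M v s p i * M (s p) i j) i) _
      _ ≤ pathWeight M v s d p i J * M (s p) i j * fin (q * d j) :=
          mul_le_mul_left (mul_le_mul_left (ih hJ) _) _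
      _ = _ := by rw [pathWeight, h]

theorem pathWeight_stay {d : Fin k → ℝ} (J : List (ℕ × Fin k)) (n : ℕ) (j : Fin k) :
    pathWeight M v s d (n + 1) j J = pathWeight M v s d n j J * fin (d j) := by
  cases J with
  | nil => rw [pathWeight, pathWeight, mul_assoc, fin_mul]; push_cast; ring_nf
  | cons e J => rw [pathWeight, pathWeight, mul_assoc _ _ (fin (d j)), fin_mul]; push_cast; ring_nf

theorem pathWeight_cons_last {d : Fin k → ℝ} (J : List (ℕ × Fin k)) (n : ℕ) (i j : Fin k) :
    pathWeight M v s d (n + 1) j ((n, i) :: J) = pathWeight M v s d n i J * M (s n) i j := by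
  rw [pathWeight, show (((n + 1 : ℕ) : ℝ) - 1 - n) * d j = 0 by push_cast; ring, fin_zero, mul_one]

theorem IsPath.succ {r : Fin k → Fin k → Prop} {J : List (ℕ × Fin k)} {n : ℕ} {j : Fin k}
    (h : IsPath r n j J) : IsPath r (n + 1) j J := by
  cases J with
  | nil => trivial
  | cons e J => exact ⟨h.1.trans n.lt_succ_self, h.2⟩

/-- For triangular matrices, the maximum is attained by a path whose jumps strictly increase the
state. -/
theorem exists_path {d : Fin k → ℝ} (hd : ∀ x i, M x i i = fin (d i))
    (hM : ∀ x i j, j < i → M x i j = 0) (n : ℕ) (j : Fin k) :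
    ∃ J, IsPath (· < ·) n j J ∧ run M v s n j = pathWeight M v s d n j J := by
  induction n generalizing j with
  | zero => exact ⟨[], trivial, by simp [run, pathWeight, fin_zero]⟩
  | succ n ih =>
    have : Nonempty (Fin k) := ⟨j⟩
    obtain ⟨i, hi⟩ := exists_sum_eq fun i => run M v s n i * M (s n) i j
    change run M v s (n + 1) j = _ at hi
    have hstay : ∀ i, i = j → run M v s (n + 1) j = run M v s n i * M (s n) i j →
        ∃ J, IsPath (· < ·) (n + 1) j J ∧
          run M v s (n + 1) j = pathWeight M v s d (n + 1) j J := by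
      rintro i rfl hi
      obtain ⟨J, hJ, h⟩ := ih i
      exact ⟨J, hJ.succ, by rw [hi, pathWeight_stay, hd, h]⟩
    rcases lt_trichotomy i j with hij | hij | hij
    · obtain ⟨J, hJ, h⟩ := ih i
      exact ⟨(n, i) :: J, ⟨n.lt_succ_self, hij, hJ⟩, by
        rw [hi, pathWeight_cons_last, h]⟩
    · exact hstay i hij hi
    · -- the maximum is `-∞`, so that staying at `j` attains it as well
      refine hstay j rfl (le_antisymm (sum_le (fun i => run M v s n i * M (s n) i j) j) ?_)
      rw [hi, hM _ _ _ hij, mul_zero]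
      exact le_zero _

theorem IsPath.mono {r r' : Fin k → Fin k → Prop} (h : ∀ i j, r i j → r' i j)
    {J : List (ℕ × Fin k)} {n : ℕ} {j : Fin k} (hJ : IsPath r n j J) : IsPath r' n j J := by
  induction J generalizing n j with
  | nil => trivial
  | cons e J ih => exact ⟨hJ.1, h _ _ hJ.2.1, ih hJ.2.2⟩

/-- A path that spends some letter at a diagonal entry can be given one more trivial jump, from a
state to itself. -/
theorem IsPath.exists_insert {d : Fin k → ℝ} (hd : ∀ x i, M x i i = fin (d i))
    {J : List (ℕ × Fin k)} {n : ℕ} {j : Fin k} (hJ : IsPath (· ≤ ·) n j J) (hn : J.length < n) :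
    ∃ J', IsPath (· ≤ ·) n j J' ∧ J'.length = J.length + 1 ∧
      pathWeight M v s d n j J' = pathWeight M v s d n j J := by
  induction J generalizing n j with
  | nil =>
    obtain ⟨m, rfl⟩ := Nat.exists_eq_succ_of_ne_zero hn.ne'
    exact ⟨[(m, j)], ⟨m.lt_succ_self, le_rfl, trivial⟩, rfl, by
      rw [pathWeight_cons_last, pathWeight_stay, hd]⟩
  | cons e J ih =>
    obtain ⟨p, i⟩ := e
    obtain ⟨hp, hij, hJ⟩ := hJ
    obtain ⟨m, rfl⟩ := Nat.exists_eq_succ_of_ne_zero (Nat.ne_zero_of_lt hp)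
    rcases (Nat.le_of_lt_succ hp).lt_or_eq with hpm | rfl
    · exact ⟨(m, j) :: (p, i) :: J, ⟨m.lt_succ_self, le_rfl, hpm, hij, hJ⟩, rfl, by
        rw [pathWeight_cons_last, pathWeight_stay, hd]⟩
    · obtain ⟨J', hJ', hlen, hw⟩ := ih hJ (Nat.lt_of_succ_lt_succ hn)
      exact ⟨(p, i) :: J', ⟨hp, hij, hJ'⟩, by simp [hlen], by rw [pathWeight, hw]; rfl⟩

/-- Trivial jumps make all paths with at most `m` jumps paths with exactly `m` jumps. -/
theorem IsPath.exists_length_eq {d : Fin k → ℝ} (hd : ∀ x i, M x i i = fin (d i))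
    {n : ℕ} {j : Fin k} (m : ℕ) (hm : m ≤ n) {J : List (ℕ × Fin k)} (hJ : IsPath (· ≤ ·) n j J)
    (hn : J.length ≤ m) :
    ∃ J', IsPath (· ≤ ·) n j J' ∧ J'.length = m ∧
      pathWeight M v s d n j J' = pathWeight M v s d n j J := by
  induction m, hn using Nat.le_induction with
  | base => exact ⟨J, hJ, rfl, rfl⟩
  | succ m _ ih =>
    obtain ⟨J', hJ', rfl, hw⟩ := ih (by omega)
    obtain ⟨J'', hJ'', h, hw'⟩ := hJ'.exists_insert (v := v) (s := s) hd (by omega)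
    exact ⟨J'', hJ'', h, hw'.trans hw⟩

theorem IsPath.length_le {n : ℕ} {j : Fin k} {J : List (ℕ × Fin k)} (hJ : IsPath (· < ·) n j J) :
    J.length ≤ j := by
  induction J generalizing n j with
  | nil => exact Nat.zero_le _
  | cons e J ih =>
    have h₁ := ih hJ.2.2
    have h₂ : (e.2 : ℕ) < j := hJ.2.1
    rw [List.length_cons]; omega

end Run

/-- In the usual order: the product along the word `mask` is at most the product along `mask'`. A
maximal path has at most three jumps, or it is the path through all five states. In the latter
case the relation on the diagonal makes its weight a function of `(p₁ + p₄, p₂, p₃)`. -/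
theorem run_le_run {M : Bool → Matrix (Fin 5) (Fin 5) MaxPlus} {v : Fin 5 → MaxPlus}
    {d : Fin 5 → ℝ} (hd : ∀ x i, M x i i = fin (d i)) (hM : ∀ x i j, j < i → M x i j = 0)
    {mask rev mask' rev' : ℕ} (hm : IsWordMask mask rev) (hm' : IsWordMask mask' rev')
    (heq : ∀ n < 25, n ≠ 12 → bit mask n = bit mask' n)
    {H₃ : Bool → Bool → Bool → List Pt}
    (h₃ : ∀ x y z, check3 mask mask' x y z (H₃ x y z) = true)
    {H₄ : Bool → Bool → Bool → Bool → List Pt}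
    (h₄ : ∀ x y z t, check4 mask mask' rev' x y z t (H₄ x y z t) = true)
    {j : Fin 5} (hj : j ≠ 4 ∨ d 0 + d 4 = d 1 + d 3) :
    run M v (bit mask') 25 j ≤ run M v (bit mask) 25 j := by
  obtain ⟨J, hJ, hw⟩ := exists_path (v := v) (s := bit mask) hd hM 25 j
  rw [hw]
  rcases Nat.lt_or_ge J.length 4 with hlen | hlen
  · obtain ⟨J, hJ, hlen, hw⟩ := (hJ.mono fun _ _ => le_of_lt).exists_length_eq (v := v)
      (s := bit mask) hd 3 (by norm_num) (Nat.le_of_lt_succ hlen)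
    rw [← hw]
    match J, hlen, hJ with
    | [(c, k₃), (b, k₂), (a, k₁)], _, ⟨hc, hk₃, hb, hk₂, ha, hk₁, _⟩ =>
    -- summation by parts turns the weight into an affine functional of the positions
    have key : ∀ s : ℕ → Bool, ∀ a b c : ℕ,
        pathWeight M v s d 25 j [(c, k₃), (b, k₂), (a, k₁)] =
          v k₁ * M (s a) k₁ k₂ * M (s b) k₂ k₃ * M (s c) k₃ j *
            fin ((24 * d j - d k₂ - d k₃) + (d k₁ - d k₂) * a + (d k₂ - d k₃) * b +
              (d k₃ - d j) * c) := by
      intro s a b c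
      simp only [pathWeight]
      rw [show (24 * d j - d k₂ - d k₃) + (d k₁ - d k₂) * a + (d k₂ - d k₃) * b +
              (d k₃ - d j) * c = a * d k₁ + ((b - 1 - a) * d k₂ + ((c - 1 - b) * d k₃ +
                (((25 : ℕ) : ℝ) - 1 - c) * d j)) by push_cast; ring]
      simp only [← fin_mul]
      ac_rfl
    rw [key]
    refine of_check3 hm hm' heq h₃ (segmentClosed_le _ _ _ _ _ _) (x := bit mask a)
      (y := bit mask b) (z := bit mask c) ?_ ha hb hc rfl rfl rfl
    intro a' b' c' hab hbc hc' hx hy hz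
    have h := run_le_pathWeight (v := v) (s := bit mask') (r := (· ≤ ·)) hd
      [(c', k₃), (b', k₂), (a', k₁)] (n := 25) (j := j)
      ⟨hc', hk₃, hbc, hk₂, hab, hk₁, trivial⟩
    rwa [key, hx, hy, hz] at h
  · have hj4 : j = 4 := by
      have := hJ.length_le
      omega
    have hlen : J.length = 4 := le_antisymm (hJ.length_le.trans (by omega)) hlen
    have hd' : d 0 + d 4 = d 1 + d 3 := hj.resolve_left (not_not_intro hj4)
    match J, hlen, hJ with
    | [(e, k₄), (c, k₃), (b, k₂), (a, k₁)], _, ⟨he, hk₄, hc, hk₃, hb, hk₂, ha, hk₁, _⟩ =>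
    -- four strict jumps pass through all five states
    obtain ⟨rfl, rfl, rfl, rfl, rfl⟩ : j = 4 ∧ k₄ = 3 ∧ k₃ = 2 ∧ k₂ = 1 ∧ k₁ = 0 := by omega
    -- by the relation on `d` the positions `a` and `e` have the same coefficient
    have key : ∀ s : ℕ → Bool, ∀ a b c e : ℕ,
        pathWeight M v s d 25 4 [(e, 3), (c, 2), (b, 1), (a, 0)] =
          v 0 * M (s a) 0 1 * M (s b) 1 2 * M (s c) 2 3 * M (s e) 3 4 *
            fin ((24 * d 4 - d 1 - d 2 - d 3) + (d 0 - d 1) * ((a + e : ℕ) : ℝ) +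
              (d 1 - d 2) * b + (d 2 - d 3) * c) := by
      intro s a b c e
      simp only [pathWeight]
      rw [show (24 * d 4 - d 1 - d 2 - d 3) + (d 0 - d 1) * ((a + e : ℕ) : ℝ) +
              (d 1 - d 2) * b + (d 2 - d 3) * c = a * d 0 + ((b - 1 - a) * d 1 + ((c - 1 - b) * d 2
                + ((e - 1 - c) * d 3 + (((25 : ℕ) : ℝ) - 1 - e) * d 4))) by
          push_cast; linear_combination (e : ℝ) * hd']
      simp only [← fin_mul]
      ac_rfl
    rw [key]
    refine of_check4 hm hm' heq h₄ (segmentClosed_le _ _ _ _ _ _) (x := bit mask a)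
      (y := bit mask b) (z := bit mask c) (t := bit mask e) ?_ ha hb hc he rfl rfl rfl rfl
    intro a' b' c' e' hab hbc hce he' hx hy hz ht
    have h := run_le_pathWeight (v := v) (s := bit mask') (r := (· < ·)) hd
      [(e', 3), (c', 2), (b', 1), (a', 0)] (n := 25) (j := 4)
      ⟨he', by decide, hce, by decide, hbc, by decide, hab, by decide, trivial⟩
    rwa [key, hx, hy, hz, ht] at h

/-- The products along `abvab` and `abuab` agree in the coordinates reached by at most three
jumps, and in all coordinates if the diagonal satisfies `d 0 + d 4 = d 1 + d 3`. -/
theorem run_wordA_eq_run_wordB {M : Bool → Matrix (Fin 5) (Fin 5) MaxPlus} (v : Fin 5 → MaxPlus)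
    {d : Fin 5 → ℝ} (hd : ∀ x i, M x i i = fin (d i)) (hM : ∀ x i j, j < i → M x i j = 0)
    {j : Fin 5} (hj : j ≠ 4 ∨ d 0 + d 4 = d 1 + d 3) :
    run M v (bit wordA) 25 j = run M v (bit wordB) 25 j :=
  le_antisymm
    (run_le_run hd hM isWordMask_B isWordMask_A (fun n hn h => (bit_wordA_eq n hn h).symm)
      check3b check4b hj)
    (run_le_run hd hM isWordMask_A isWordMask_B bit_wordA_eq check3a check4a hj)

/-! ### Tropical representations and their invariants -/

/-- The inclusion of `ℕ ∪ {-∞}` into `ℝ ∪ {-∞}`. -/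
noncomputable def ofNat : NatMaxPlus →+* MaxPlus where
  toFun t := trop ((untrop t).map fun n => OrderDual.toDual ((OrderDual.ofDual n : ℕ) : ℝ))
  map_zero' := rfl
  map_one' := by
    change trop (((OrderDual.toDual ((0 : ℕ) : ℝ) : ℝᵒᵈ) : WithTop ℝᵒᵈ)) = 1
    rw [Nat.cast_zero]; rfl
  map_add' x y := by
    have hmono : Monotone fun n : ℕᵒᵈ => OrderDual.toDual ((OrderDual.ofDual n : ℕ) : ℝ) :=
      fun a b h => by
        have h' : (OrderDual.ofDual b) ≤ OrderDual.ofDual a := h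
        exact OrderDual.toDual_le_toDual.2 (by exact_mod_cast h')
    apply untrop_injective
    rw [untrop_add, untrop_add]
    exact (WithTop.monotone_map_iff.2 hmono).map_min
  map_mul' x y := by
    apply untrop_injective
    rw [untrop_mul, untrop_mul]
    induction x using Tropical.tropRec with
    | h x =>
    induction y using Tropical.tropRec with
    | h y =>
    cases x using WithTop.recTopCoe with
    | top => rfl
    | coe x =>
    cases y using WithTop.recTopCoe with
    | top => rfl
    | coe y =>
      change ((OrderDual.toDual (((OrderDual.ofDual x + OrderDual.ofDual y : ℕ)) : ℝ) : ℝᵒᵈ) :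
        WithTop ℝᵒᵈ) = _
      rw [Nat.cast_add]; rfl

theorem ofNat_nfin (n : ℕ) : ofNat (nfin n) = fin n := rfl

/-- The generator of the plactic monoid given by the letter `x`; the letters are `0, 1, 2, 3`. -/
abbrev gen (x : Fin 4) : PlacticMonoid 4 := PresentedMonoid.of (KnuthRel 4) x

theorem gen_bca {a b c : Fin 4} (hab : a < b) (hbc : b ≤ c) :
    gen b * gen c * gen a = gen b * gen a * gen c :=
  PresentedMonoid.mk_eq_mk_of_rel (KnuthRel.bca a b c hab hbc)

theorem gen_cab {a b c : Fin 4} (hab : a ≤ b) (hbc : b < c) :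
    gen c * gen a * gen b = gen a * gen c * gen b :=
  PresentedMonoid.mk_eq_mk_of_rel (KnuthRel.cab a b c hab hbc)

theorem plactic_induction {P : PlacticMonoid 4 → Prop} (one : P 1)
    (mul_gen : ∀ w x, P w → P (w * gen x)) (w : PlacticMonoid 4) : P w := by
  have hw : w ∈ Submonoid.closure (Set.range (PresentedMonoid.of (KnuthRel 4))) := by
    rw [PresentedMonoid.closure_range_of]; trivial
  induction hw using Submonoid.closure_induction_right with
  | one => exact one
  | mul_right w _ y hy ih =>
    obtain ⟨x, rfl⟩ := hy
    exact mul_gen w x ih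

/-- The homomorphism from the plactic monoid given by images of the letters that satisfy the Knuth
relations. -/
def knuthLift {M : Type*} [Monoid M] (f : Fin 4 → M)
    (hb : ∀ a b c : Fin 4, a < b → b ≤ c → f b * f c * f a = f b * f a * f c)
    (hc : ∀ a b c : Fin 4, a ≤ b → b < c → f c * f a * f b = f a * f c * f b) :
    PlacticMonoid 4 →* M :=
  PresentedMonoid.lift f (by
    intro p q h
    cases h with
    | bca a b c h₁ h₂ => simpa using hb a b c h₁ h₂
    | cab a b c h₁ h₂ => simpa using hc a b c h₁ h₂)

/-- The representation on subsets with one element: the entry at `(i, j)`, for letters `i ≤ j`, is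
the maximal length of a weakly increasing subsequence with letters in `[i, j]`. -/
noncomputable def rowRep : PlacticMonoid 4 →* Matrix (Fin 5) (Fin 5) MaxPlus :=
  (RingHom.toMonoidHom ofNat.mapMatrix).comp (knuthLift rowGen
    (fun a b c h₁ h₂ => Matrix.ext (row_b a b c h₁ h₂))
      fun a b c h₁ h₂ => Matrix.ext (row_c a b c h₁ h₂))

/-- The representation on subsets with three elements. -/
noncomputable def colRep : PlacticMonoid 4 →* Matrix (Fin 5) (Fin 5) MaxPlus :=
  (RingHom.toMonoidHom ofNat.mapMatrix).comp (knuthLift colGen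
    (fun a b c h₁ h₂ => Matrix.ext (col_b a b c h₁ h₂))
      fun a b c h₁ h₂ => Matrix.ext (col_c a b c h₁ h₂))

/-- The representation on subsets with two elements. -/
noncomputable def pairRep : PlacticMonoid 4 →* Matrix (Fin 6) (Fin 6) MaxPlus :=
  (RingHom.toMonoidHom ofNat.mapMatrix).comp (knuthLift pairGen
    (fun a b c h₁ h₂ => Matrix.ext (pair_b a b c h₁ h₂))
      fun a b c h₁ h₂ => Matrix.ext (pair_c a b c h₁ h₂))

/-- The number of occurrences of the letter `i`, as an element of the max-plus semiring. -/
noncomputable def count (i : Fin 4) : PlacticMonoid 4 →* MaxPlus :=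
  knuthLift (fun x => if x = i then fin 1 else 1) (fun _ _ _ _ _ => mul_right_comm _ _ _)
    fun _ _ _ _ _ => by rw [mul_comm (ite _ _ _) (ite _ _ _)]

theorem rowRep_gen (x : Fin 4) (i j : Fin 5) : rowRep (gen x) i j = ofNat (rowGen x i j) := rfl

theorem colRep_gen (x : Fin 4) (i j : Fin 5) : colRep (gen x) i j = ofNat (colGen x i j) := rfl

theorem pairRep_gen (x : Fin 4) (i j : Fin 6) : pairRep (gen x) i j = ofNat (pairGen x i j) := rfl

theorem count_gen (i x : Fin 4) : count i (gen x) = if x = i then fin 1 else 1 := rfl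

/-! ### Triangularity and diagonals -/

theorem diag_mul_of_upper {k : ℕ} {A B : Matrix (Fin k) (Fin k) MaxPlus}
    (hA : A.IsUpperTriangular) (hB : B.IsUpperTriangular) (i : Fin k) :
    (A * B) i i = A i i * B i i := by
  rw [Matrix.mul_apply]
  refine Finset.sum_eq_single i (fun j _ hj => ?_) (by simp)
  rcases lt_or_gt_of_ne hj with h | h
  · rw [hA h, zero_mul]
  · rw [hB h, mul_zero]

theorem upper_of_gen {k : ℕ} (ρ : PlacticMonoid 4 →* Matrix (Fin k) (Fin k) MaxPlus)
    (h : ∀ x, (ρ (gen x)).IsUpperTriangular) (w : PlacticMonoid 4) : (ρ w).IsUpperTriangular := by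
  induction w using plactic_induction with
  | one => rw [map_one]; exact blockTriangular_one
  | mul_gen w x ih => rw [map_mul]; exact ih.mul (h x)

/-- The diagonal of a triangular representation is finite and inherits additive relations from the
generators. -/
theorem exists_diag_of_gen {k : ℕ} (ρ : PlacticMonoid 4 →* Matrix (Fin k) (Fin k) MaxPlus)
    (h : ∀ x, (ρ (gen x)).IsUpperTriangular) (S : AddSubmonoid (Fin k → ℝ))
    (hS : ∀ x, ∃ d ∈ S, ∀ i, ρ (gen x) i i = fin (d i)) (w : PlacticMonoid 4) :
    ∃ d ∈ S, ∀ i, ρ w i i = fin (d i) := by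
  induction w using plactic_induction with
  | one => exact ⟨0, S.zero_mem, fun i => by rw [map_one, one_apply_eq, Pi.zero_apply, fin_zero]⟩
  | mul_gen w x ih =>
    obtain ⟨d, hd, h₁⟩ := ih
    obtain ⟨d', hd', h₂⟩ := hS x
    refine ⟨d + d', S.add_mem hd hd', fun i => ?_⟩
    rw [map_mul, diag_mul_of_upper (upper_of_gen ρ h w) (h x), h₁, h₂, fin_mul, Pi.add_apply]

theorem rowRep_upper (w : PlacticMonoid 4) : (rowRep w).IsUpperTriangular :=
  upper_of_gen rowRep (fun x i j h => by
    rw [rowRep_gen, show rowGen x i j = 0 from if_neg (not_le.2 h), map_zero]) w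

theorem colRep_upper (w : PlacticMonoid 4) : (colRep w).IsUpperTriangular :=
  upper_of_gen colRep (fun x i j h => by
    rw [colRep_gen, show colGen x i j = 0 from if_neg (not_le.2 h), map_zero]) w

theorem not_pair_le : ∀ i j : Fin 6, j < i ∨ i = 2 ∧ j = 3 →
    ¬(pairFst i ≤ pairFst j ∧ pairSnd i ≤ pairSnd j) := by
  decide

theorem pairRep_upper (w : PlacticMonoid 4) : (pairRep w).IsUpperTriangular :=
  upper_of_gen pairRep (fun x i j h => by
    rw [pairRep_gen, show pairGen x i j = 0 from if_neg (not_pair_le i j (.inl h)), map_zero]) w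

theorem exists_diag_rowRep (w : PlacticMonoid 4) : ∃ d : Fin 5 → ℝ, ∀ i,
    rowRep w i i = fin (d i) := by
  obtain ⟨d, -, h⟩ := exists_diag_of_gen rowRep (fun x => rowRep_upper _) ⊤ (fun x =>
    ⟨fun i => ((if i ≤ x.castSucc ∧ x.castSucc ≤ i then 1 else 0 : ℕ) : ℝ), trivial, fun i => by
      rw [rowRep_gen, rowGen, if_pos le_rfl, ofNat_nfin]⟩) w
  exact ⟨d, h⟩

theorem exists_diag_colRep (w : PlacticMonoid 4) : ∃ d : Fin 5 → ℝ, ∀ i,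
    colRep w i i = fin (d i) := by
  obtain ⟨d, -, h⟩ := exists_diag_of_gen colRep (fun x => colRep_upper _) ⊤ (fun x =>
    ⟨fun i => ((if i = i ∧ i = x.rev.castSucc then 0 else 1 : ℕ) : ℝ), trivial, fun i => by
      rw [colRep_gen, colGen, if_pos le_rfl, ofNat_nfin]⟩) w
  exact ⟨d, h⟩

/-- The number of times that the letter `x` occurs in the `i`-th subset with two elements. -/
def pairIndicator (x : Fin 4) (i : Fin 6) : ℕ := if x = pairFst i ∨ x = pairSnd i then 1 else 0

theorem pairGen_diag : ∀ x i, pairGen x i i = nfin (pairIndicator x i) := by decide +kernel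

/-- The diagonal entry of `pairRep w` at a subset is the number of letters of `w` in it. The linear
relation holds because `{0,1}`, `{2,3}` and `{0,2}`, `{1,3}` are two partitions of the alphabet. -/
theorem exists_diag_pairRep (w : PlacticMonoid 4) :
    ∃ d : Fin 6 → ℝ, d 0 + d 5 = d 1 + d 4 ∧ ∀ i, pairRep w i i = fin (d i) := by
  let S : AddSubmonoid (Fin 6 → ℝ) :=
    { carrier := {d | d 0 + d 5 = d 1 + d 4}
      zero_mem' := by simp
      add_mem' := fun {d d'} hd hd' => by
        simp only [Set.mem_ofPred_eq, Pi.add_apply] at *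
        linear_combination hd + hd' }
  have hind : ∀ x, pairIndicator x 0 + pairIndicator x 5 = pairIndicator x 1 + pairIndicator x 4 :=
    by
    decide
  obtain ⟨d, hd, h⟩ := exists_diag_of_gen pairRep (fun x => pairRep_upper _) S (fun x =>
    ⟨fun i => (pairIndicator x i : ℝ), by
      change (pairIndicator x 0 + pairIndicator x 5 : ℝ) = pairIndicator x 1 + pairIndicator x 4
      exact_mod_cast hind x, fun i => by
      rw [pairRep_gen, pairGen_diag, ofNat_nfin]⟩) w
  exact ⟨d, hd, h⟩

/-- The subsets `{0,3}` and `{1,2}`, with indices `2` and `3`, are incomparable. -/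
theorem pairRep_two_three (w : PlacticMonoid 4) : pairRep w 2 3 = 0 := by
  induction w using plactic_induction with
  | one => rw [map_one]; exact one_apply_ne (by decide)
  | mul_gen w x ih =>
    have hx : pairRep (gen x) 2 3 = 0 := by
      rw [pairRep_gen, show pairGen x 2 3 = 0 from if_neg (not_pair_le 2 3 (.inr ⟨rfl, rfl⟩)),
        map_zero]
    rw [map_mul, mul_apply, Fin.sum_univ_six, pairRep_upper w (show (0 : Fin 6) < 2 by decide),
      pairRep_upper w (show (1 : Fin 6) < 2 by decide), ih, hx,
      pairRep_upper (gen x) (show (3 : Fin 6) < 4 by decide),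
      pairRep_upper (gen x) (show (3 : Fin 6) < 5 by decide)]
    simp

/-! ### The two maximal chains of two-element subsets -/

/-- The maximal chain `{0,1} < {0,2} < {0,3} < {1,3} < {2,3}`. -/
def chainA : Fin 5 → Fin 6 := ![0, 1, 2, 4, 5]

/-- The maximal chain `{0,1} < {0,2} < {1,2} < {1,3} < {2,3}`. -/
def chainB : Fin 5 → Fin 6 := ![0, 1, 3, 4, 5]

/-- The vector `v`, indexed by the subsets with two elements, is assembled from vectors along the
two maximal chains: they agree below the middle of the chains, give the two incomparable entries
in the middle, and `v` is their maximum above it. -/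
structure IsSplit (v : Fin 6 → MaxPlus) (vA vB : Fin 5 → MaxPlus) : Prop where
  zeroA : v 0 = vA 0
  zeroB : v 0 = vB 0
  oneA : v 1 = vA 1
  oneB : v 1 = vB 1
  two : v 2 = vA 2
  three : v 3 = vB 2
  four : v 4 = vA 3 + vB 3
  five : v 5 = vA 4 + vB 4

theorem IsSplit.eq {v v' : Fin 6 → MaxPlus} {vA vB : Fin 5 → MaxPlus} (h : IsSplit v vA vB)
    (h' : IsSplit v' vA vB) : v = v' := by
  funext i
  fin_cases i
  · exact h.zeroA.trans h'.zeroA.symm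
  · exact h.oneA.trans h'.oneA.symm
  · exact h.two.trans h'.two.symm
  · exact h.three.trans h'.three.symm
  · exact h.four.trans h'.four.symm
  · exact h.five.trans h'.five.symm

theorem isSplit_one : IsSplit 1 1 1 := by
  constructor <;> simp

/-- By idempotency the common summand `x` may be used in both sums on the right. -/
theorem add_split (x a b c d e f : MaxPlus) :
    x + a + b + (c + d) + (e + f) = x + a + c + e + (x + b + d + f) := by
  calc x + a + b + (c + d) + (e + f) = (x + x) + a + b + (c + d) + (e + f) := by
        rw [Tropical.add_self x]
    _ = _ := by ac_rfl

/-- A path of subsets runs in one of the two chains, so the product with a matrix of `pairRep` can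
be computed along the chains. -/
theorem IsSplit.vecMul {v : Fin 6 → MaxPlus} {vA vB : Fin 5 → MaxPlus} (h : IsSplit v vA vB)
    {M : Matrix (Fin 6) (Fin 6) MaxPlus} (hM : M.IsUpperTriangular) (hM' : M 2 3 = 0) :
    IsSplit (v ᵥ* M) (vA ᵥ* M.submatrix chainA chainA) (vB ᵥ* M.submatrix chainB chainB) := by
  obtain ⟨h0, h0', h1, h1', h2, h3, h4, h5⟩ := h
  have hz : ∀ i j : Fin 6, j < i → M i j = 0 := fun i j h => hM h
  constructor <;> simp only [Matrix.vecMul, dotProduct, Fin.sum_univ_six, Fin.sum_univ_five,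
    submatrix_apply, chainA, chainB,
    cons_val, hM', hz _ _ (show (0 : Fin 6) < 1 by decide), hz _ _ (show (0 : Fin 6) < 2 by decide),
    hz _ _ (show (0 : Fin 6) < 3 by decide), hz _ _ (show (0 : Fin 6) < 4 by decide),
    hz _ _ (show (0 : Fin 6) < 5 by decide), hz _ _ (show (1 : Fin 6) < 2 by decide),
    hz _ _ (show (1 : Fin 6) < 3 by decide), hz _ _ (show (1 : Fin 6) < 4 by decide),
    hz _ _ (show (1 : Fin 6) < 5 by decide), hz _ _ (show (2 : Fin 6) < 3 by decide),
    hz _ _ (show (2 : Fin 6) < 4 by decide), hz _ _ (show (2 : Fin 6) < 5 by decide),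
    hz _ _ (show (3 : Fin 6) < 4 by decide), hz _ _ (show (3 : Fin 6) < 5 by decide),
    hz _ _ (show (4 : Fin 6) < 5 by decide), mul_zero, add_zero]
  · rw [h0]
  · rw [h0']
  · rw [h0, h1]
  · rw [h0', h1']
  · rw [h0, h1, h2]
  · rw [h0', h1', h3]
  · rw [← h0, ← h0', ← h1, ← h1', h2, h3, h4, add_mul]
    have h := add_split (v 0 * M 0 4 + v 1 * M 1 4) (vA 2 * M 2 4) (vB 2 * M 3 4) (vA 3 * M 4 4)
      (vB 3 * M 4 4) 0 0
    simpa only [add_zero] using h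
  · rw [← h0, ← h0', ← h1, ← h1', h2, h3, h4, h5, add_mul, add_mul]
    exact add_split _ _ _ _ _ _ _

/-! ### Transfer of identities -/

theorem isSplit_lift {X : Type*} (φ : FreeSemigroup X →ₙ* PlacticMonoid 4) (p : FreeSemigroup X)
    {v : Fin 6 → MaxPlus} {vA vB : Fin 5 → MaxPlus} (h : IsSplit v vA vB) :
    IsSplit (v ᵥ* pairRep (φ p))
      (vA ᵥ* FreeSemigroup.lift
        (fun x => (pairRep (φ (FreeSemigroup.of x))).submatrix chainA chainA) p)
      (vB ᵥ* FreeSemigroup.lift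
        (fun x => (pairRep (φ (FreeSemigroup.of x))).submatrix chainB chainB) p) := by
  induction p using FreeSemigroup.recOnMul generalizing v vA vB with
  | ih1 x =>
    rw [FreeSemigroup.lift_of, FreeSemigroup.lift_of]
    exact h.vecMul (pairRep_upper _) (pairRep_two_three _)
  | ih2 x p ihx ihp =>
    rw [map_mul, map_mul, map_mul, map_mul, ← vecMul_vecMul, ← vecMul_vecMul, ← vecMul_vecMul]
    exact ihp (ihx h)

theorem strictMono_chainA : StrictMono chainA := by decide

theorem strictMono_chainB : StrictMono chainB := by decide

theorem upper_submatrix {M : Matrix (Fin 6) (Fin 6) MaxPlus} (hM : M.IsUpperTriangular)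
    {c : Fin 5 → Fin 6} (hc : StrictMono c) : (M.submatrix c c).IsUpperTriangular :=
  fun _ _ h => hM (hc h)

/-- An identity of `UT n` holds for all assignments of upper triangular matrices to the variables.
-/
theorem lift_eq_of_satisfiesIdentity {n : ℕ} {X : Type*} {p q : FreeSemigroup X}
    (h : SatisfiesIdentity (UT n) p q) (m : X → Matrix (Fin n) (Fin n) MaxPlus)
    (hm : ∀ x, (m x).IsUpperTriangular) :
    FreeSemigroup.lift m p = FreeSemigroup.lift m q := by
  let ψ : FreeSemigroup X →ₙ* UT n := FreeSemigroup.lift fun x => ⟨m x, hm x⟩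
  have hψ : ((MulMemClass.subtype (UT n)).comp ψ) = FreeSemigroup.lift m := by
    refine FreeSemigroup.hom_ext ?_
    funext x
    simp [ψ]
  rw [← hψ]
  exact congrArg Subtype.val (h ψ)

/-- The tropical invariants that determine an element of the plactic monoid: the number of
occurrences of each letter, and the maximal weights of the paths ending at a given subset in the
three representations. The last coordinate of `rowRep` and `colRep` is not used. -/
structure SameInvariants (p q : PlacticMonoid 4) : Prop where
  count : ∀ i, count i p = count i q
  row : ∀ j ≠ 4, (1 ᵥ* rowRep p) j = (1 ᵥ* rowRep q) j
  col : ∀ j ≠ 4, (1 ᵥ* colRep p) j = (1 ᵥ* colRep q) j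
  pair : (1 ᵥ* pairRep p) = (1 ᵥ* pairRep q)

theorem lift_comp {X S T : Type*} [Semigroup S] [Semigroup T] (φ : FreeSemigroup X →ₙ* S)
    (ρ : S →ₙ* T) (p : FreeSemigroup X) :
    FreeSemigroup.lift (fun x => ρ (φ (FreeSemigroup.of x))) p = ρ (φ p) := by
  have : FreeSemigroup.lift (fun x => ρ (φ (FreeSemigroup.of x))) = ρ.comp φ := by
    refine FreeSemigroup.hom_ext ?_
    funext x
    simp
  rw [this]; rfl

/-- The scalar matrices, as a homomorphism of multiplicative semigroups. -/
noncomputable def scalar (n : ℕ) : MaxPlus →ₙ* Matrix (Fin n) (Fin n) MaxPlus :=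
  (Matrix.scalar (Fin n) : MaxPlus →+* _)

/-- Identities of `UT 5` hold for the invariants of the plactic monoid. -/
theorem sameInvariants_of_satisfiesIdentity {X : Type*} {p q : FreeSemigroup X}
    (h : SatisfiesIdentity (UT 5) p q) (φ : FreeSemigroup X →ₙ* PlacticMonoid 4) :
    SameInvariants (φ p) (φ q) where
  count i := by
    have h := lift_eq_of_satisfiesIdentity h (fun x => ((scalar 5).comp (count i : _ →ₙ* _))
      (φ (FreeSemigroup.of x)))
      (fun x => blockTriangular_diagonal _)
    rw [lift_comp, lift_comp] at h
    simpa [scalar] using congrFun (congrFun h 0) 0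
  row j _ := by
    have h := lift_eq_of_satisfiesIdentity h (fun x => (rowRep : _ →ₙ* _)
      (φ (FreeSemigroup.of x))) fun x => rowRep_upper _
    rw [lift_comp, lift_comp] at h
    exact congrArg (fun M => (1 ᵥ* M) j) h
  col j _ := by
    have h := lift_eq_of_satisfiesIdentity h (fun x => (colRep : _ →ₙ* _)
      (φ (FreeSemigroup.of x))) fun x => colRep_upper _
    rw [lift_comp, lift_comp] at h
    exact congrArg (fun M => (1 ᵥ* M) j) h
  pair := by
    have hA := lift_eq_of_satisfiesIdentity h (fun x => (pairRep
      (φ (FreeSemigroup.of x))).submatrix chainA chainA)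
      fun x => upper_submatrix (pairRep_upper _) strictMono_chainA
    have hB := lift_eq_of_satisfiesIdentity h (fun x => (pairRep
      (φ (FreeSemigroup.of x))).submatrix chainB chainB)
      fun x => upper_submatrix (pairRep_upper _) strictMono_chainB
    have h₁ := isSplit_lift φ p isSplit_one
    rw [hA, hB] at h₁
    exact h₁.eq (isSplit_lift φ q isSplit_one)

open Word in
theorem vecMul_lift_u {k : ℕ} (m : Fin 2 → Matrix (Fin k) (Fin k) MaxPlus) (v : Fin k → MaxPlus) :
    v ᵥ* FreeSemigroup.lift m (a * b * u * a * b) =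
      run (fun x => m (cond x 1 0)) v (bit wordB) 25 := by
  simp only [Word.u, Word.w, Word.a, Word.b, map_mul, FreeSemigroup.lift_of, ← vecMul_vecMul, run]
  rfl

open Word in
theorem vecMul_lift_v {k : ℕ} (m : Fin 2 → Matrix (Fin k) (Fin k) MaxPlus) (w : Fin k → MaxPlus) :
    w ᵥ* FreeSemigroup.lift m (a * b * v * a * b) =
      run (fun x => m (cond x 1 0)) w (bit wordA) 25 := by
  simp only [Word.v, Word.w, Word.a, Word.b, map_mul, FreeSemigroup.lift_of, ← vecMul_vecMul, run]
  rfl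

open Word in
theorem vecMul_lift_eq (m : Fin 2 → Matrix (Fin 5) (Fin 5) MaxPlus) (w : Fin 5 → MaxPlus)
    (hm : ∀ x, (m x).IsUpperTriangular) {d : Fin 5 → ℝ} (hd : ∀ x i, m x i i = fin (d i))
    {j : Fin 5} (hj : j ≠ 4 ∨ d 0 + d 4 = d 1 + d 3) :
    (w ᵥ* FreeSemigroup.lift m (a * b * u * a * b)) j =
      (w ᵥ* FreeSemigroup.lift m (a * b * v * a * b)) j := by
  rw [vecMul_lift_u, vecMul_lift_v]
  exact (run_wordA_eq_run_wordB w (fun x i => hd _ i) (fun x i j h => hm _ h) hj).symm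

/-- The images of `y * x` and `x * y` in a triangular representation have the same diagonal. -/
theorem diag_swap {k : ℕ} {ρ : PlacticMonoid 4 →* Matrix (Fin k) (Fin k) MaxPlus}
    (hρ : ∀ w, (ρ w).IsUpperTriangular) (x y : PlacticMonoid 4) (i : Fin k) :
    ρ (y * x) i i = ρ (x * y) i i := by
  rw [map_mul, map_mul, diag_mul_of_upper (hρ y) (hρ x), diag_mul_of_upper (hρ x) (hρ y), mul_comm]

open Word in
/-- The two words of the identity, evaluated at `x * y` and `y * x`, have the same invariants. -/
theorem sameInvariants_eval (x y : PlacticMonoid 4) :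
    SameInvariants ((a * b * u * a * b).eval (x * y) (y * x))
      ((a * b * v * a * b).eval (x * y) (y * x)) where
  count i := by
    simp only [Word.eval, Word.u, Word.v, Word.w, Word.a, Word.b, map_mul, FreeSemigroup.lift_of,
      cons_val_zero, cons_val_one]
    ac_rfl
  row j hj := by
    obtain ⟨d, hd⟩ := exists_diag_rowRep (x * y)
    have h := vecMul_lift_eq (fun t => (rowRep : _ →ₙ* _)
      (FreeSemigroup.lift ![x * y, y * x] (FreeSemigroup.of t))) 1 (fun t => rowRep_upper _)
      (d := d) (fun t i => by
        fin_cases t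
        · exact hd i
        · exact (diag_swap rowRep_upper x y i).trans (hd i)) (.inl hj)
    rwa [lift_comp, lift_comp] at h
  col j hj := by
    obtain ⟨d, hd⟩ := exists_diag_colRep (x * y)
    have h := vecMul_lift_eq (fun t => (colRep : _ →ₙ* _)
      (FreeSemigroup.lift ![x * y, y * x] (FreeSemigroup.of t))) 1 (fun t => colRep_upper _)
      (d := d) (fun t i => by
        fin_cases t
        · exact hd i
        · exact (diag_swap colRep_upper x y i).trans (hd i)) (.inl hj)
    rwa [lift_comp, lift_comp] at h
  pair := by
    obtain ⟨d, hd, hdiag⟩ := exists_diag_pairRep (x * y)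
    have key : ∀ c : Fin 5 → Fin 6, StrictMono c → d (c 0) + d (c 4) = d (c 1) + d (c 3) →
        1 ᵥ* FreeSemigroup.lift (fun t => (pairRep (FreeSemigroup.lift ![x * y, y * x]
          (FreeSemigroup.of t))).submatrix c c) (a * b * u * a * b) =
        1 ᵥ* FreeSemigroup.lift (fun t => (pairRep (FreeSemigroup.lift ![x * y, y * x]
          (FreeSemigroup.of t))).submatrix c c) (a * b * v * a * b) := by
      intro c hc hdc
      funext j
      refine vecMul_lift_eq _ 1 (fun t => upper_submatrix (pairRep_upper _) hc)
        (d := fun i => d (c i)) (fun t i => ?_) (.inr hdc)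
      fin_cases t
      · exact hdiag _
      · exact (diag_swap pairRep_upper x y _).trans (hdiag _)
    have h₁ := isSplit_lift (FreeSemigroup.lift ![x * y, y * x]) (a * b * u * a * b) isSplit_one
    rw [key _ strictMono_chainA hd, key _ strictMono_chainB hd] at h₁
    exact h₁.eq (isSplit_lift _ _ isSplit_one)

/-! ### Row insertion and tableaux -/

/-- The word `0ᵃ 1ᵇ 2ᶜ 3ᵈ`. -/
def rowWord (a b c d : ℕ) : PlacticMonoid 4 := gen 0 ^ a * gen 1 ^ b * gen 2 ^ c * gen 3 ^ d

/-- The element of the plactic monoid represented by a list of letters. -/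
def word (l : List (Fin 4)) : PlacticMonoid 4 := (l.map gen).prod

theorem word_cons (x : Fin 4) (l : List (Fin 4)) : word (x :: l) = gen x * word l := List.prod_cons

theorem word_append (l m : List (Fin 4)) : word (l ++ m) = word l * word m := by
  simp [word]

/-- In a row `y l` followed by a letter `x < y`, this letter moves to the left as far as `y`. -/
theorem gen_mul_word_mul_gen {x y : Fin 4} (hxy : x < y) {l : List (Fin 4)}
    (hl : (y :: l).IsChain (· ≤ ·)) : gen y * word l * gen x = gen y * gen x * word l := by
  induction l generalizing y with
  | nil => simp [word]
  | cons z l ih =>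
    obtain ⟨hyz, hl⟩ := List.isChain_cons_cons.1 hl
    rw [word_cons, mul_assoc, mul_assoc (gen z), ← mul_assoc (gen z), ih (hxy.trans_le hyz) hl,
      ← mul_assoc, ← mul_assoc, gen_bca hxy hyz, ← mul_assoc]

/-- In a row `l x` with a letter `y > x` inserted in front of `x`, the letter `y` moves to the
left end. -/
theorem word_mul_gen_mul_gen {x y : Fin 4} (hxy : x < y) {l : List (Fin 4)}
    (hl : (l ++ [x]).IsChain (· ≤ ·)) : word l * gen y * gen x = gen y * word l * gen x := by
  induction l with
  | nil => simp [word]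
  | cons z l ih =>
    have hl' : (l ++ [x]).IsChain (· ≤ ·) := hl.tail
    rw [word_cons, mul_assoc, mul_assoc, ← mul_assoc (word l), ih hl']
    cases l with
    | nil =>
      have hzx : z ≤ x := by simpa using hl
      simp only [word, List.map_nil, List.prod_nil, mul_one, ← mul_assoc]
      exact (gen_cab hzx hxy).symm
    | cons t l =>
      have hzt : z ≤ t := (List.isChain_cons_cons.1 hl).1
      have hty : t < y := by
        have : t ≤ x := by
          have h := (List.isChain_iff_pairwise.1 hl').rel_of_mem_append
            (List.mem_cons_self : t ∈ t :: l) (List.mem_singleton_self x)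
          exact h
        exact this.trans_lt hxy
      rw [word_cons]
      simp only [← mul_assoc]
      rw [← gen_cab hzt hty]

/-- Row insertion: inserting `x` into the row `l y m` replaces `y` by `x`, and `y` leaves the row
on the left. -/
theorem bump {x y : Fin 4} (hxy : x < y) {l m : List (Fin 4)} (hl : (l ++ [x]).IsChain (· ≤ ·))
    (hm : (y :: m).IsChain (· ≤ ·)) :
    word l * gen y * word m * gen x = gen y * (word l * gen x * word m) := by
  rw [mul_assoc, mul_assoc, ← mul_assoc (gen y), gen_mul_word_mul_gen hxy hm, ← mul_assoc,
    ← mul_assoc, word_mul_gen_mul_gen hxy hl]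
  simp only [mul_assoc]

theorem word_replicate (n : ℕ) (x : Fin 4) : word (List.replicate n x) = gen x ^ n := by
  simp [word]

/-- The row `0ᵃ 1ᵇ 2ᶜ 3ᵈ` as a list of letters. -/
def rowList (a b c d : ℕ) : List (Fin 4) :=
  List.replicate a 0 ++ List.replicate b 1 ++ List.replicate c 2 ++ List.replicate d 3

theorem word_rowList (a b c d : ℕ) : word (rowList a b c d) = rowWord a b c d := by
  simp only [rowList, rowWord, word_append, word_replicate]

theorem isChain_rowList (a b c d : ℕ) : (rowList a b c d).IsChain (· ≤ ·) := by
  rw [List.isChain_iff_pairwise]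
  simp only [rowList, List.pairwise_append, List.pairwise_replicate, List.mem_append,
    List.mem_replicate]
  refine ⟨⟨⟨by simp, by simp, ?_⟩, by simp, ?_⟩, by simp, ?_⟩ <;> rintro i hi j ⟨-, rfl⟩ <;> omega

theorem insert_three (a b c d : ℕ) : rowWord a b c d * gen 3 = rowWord a b c (d + 1) := by
  simp only [rowWord, pow_succ, mul_assoc]

theorem insert_two (a b c : ℕ) : rowWord a b c 0 * gen 2 = rowWord a b (c + 1) 0 := by
  simp only [rowWord, pow_succ, pow_zero, mul_assoc, mul_one]

theorem insert_one (a b : ℕ) : rowWord a b 0 0 * gen 1 = rowWord a (b + 1) 0 0 := by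
  simp only [rowWord, pow_succ, pow_zero, mul_assoc, mul_one]

theorem insert_zero (a : ℕ) : rowWord a 0 0 0 * gen 0 = rowWord (a + 1) 0 0 0 := by
  simp only [rowWord, pow_succ, pow_zero, mul_one]

theorem bump_row {x y : Fin 4} (hxy : x < y) {a b c d a' b' c' d' : ℕ}
    (hl : ∀ z ∈ rowList a b c d, z ≤ x) (hm : ∀ z ∈ rowList a' b' c' d', y ≤ z) :
    rowWord a b c d * gen y * rowWord a' b' c' d' * gen x =
      gen y * (rowWord a b c d * gen x * rowWord a' b' c' d') := by
  simp only [← word_rowList]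
  refine bump hxy ?_ ?_ <;> rw [List.isChain_iff_pairwise]
  · exact List.pairwise_append.2 ⟨(List.isChain_iff_pairwise.1 (isChain_rowList _ _ _ _)), by simp,
      fun z hz t ht => by rw [List.mem_singleton.1 ht]; exact hl z hz⟩
  · exact List.pairwise_cons.2 ⟨hm, List.isChain_iff_pairwise.1 (isChain_rowList _ _ _ _)⟩

theorem mem_rowList {a b c d : ℕ} {z : Fin 4} : z ∈ rowList a b c d ↔
    (a ≠ 0 ∧ z = 0) ∨ (b ≠ 0 ∧ z = 1) ∨ (c ≠ 0 ∧ z = 2) ∨ (d ≠ 0 ∧ z = 3) := by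
  simp [rowList, List.mem_replicate]

theorem gen_pow_mul_gen_mul (x : Fin 4) (n : ℕ) (w : PlacticMonoid 4) :
    gen x ^ n * (gen x * w) = gen x * (gen x ^ n * w) := by
  rw [← mul_assoc, ← mul_assoc, pow_mul_comm']

theorem bump_three_two (a b c d : ℕ) :
    rowWord a b c (d + 1) * gen 2 = gen 3 * rowWord a b (c + 1) d := by
  have h := bump_row (show (2 : Fin 4) < 3 by decide) (a := a) (b := b) (c := c) (d := 0) (a' := 0)
    (b' := 0) (c' := 0) (d' := d) (by simp only [mem_rowList]; omega)
    (by simp only [mem_rowList]; omega)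
  simpa only [rowWord, pow_zero, mul_one, one_mul, mul_assoc, pow_succ',
    gen_pow_mul_gen_mul] using h

theorem bump_two_one (a b c d : ℕ) :
    rowWord a b (c + 1) d * gen 1 = gen 2 * rowWord a (b + 1) c d := by
  have h := bump_row (show (1 : Fin 4) < 2 by decide) (a := a) (b := b) (c := 0) (d := 0) (a' := 0)
    (b' := 0) (c' := c) (d' := d) (by simp only [mem_rowList]; omega)
    (by simp only [mem_rowList]; omega)
  simpa only [rowWord, pow_zero, mul_one, one_mul, mul_assoc, pow_succ',
    gen_pow_mul_gen_mul] using h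

theorem bump_three_one (a b d : ℕ) :
    rowWord a b 0 (d + 1) * gen 1 = gen 3 * rowWord a (b + 1) 0 d := by
  have h := bump_row (show (1 : Fin 4) < 3 by decide) (a := a) (b := b) (c := 0) (d := 0) (a' := 0)
    (b' := 0) (c' := 0) (d' := d) (by simp only [mem_rowList]; omega)
    (by simp only [mem_rowList]; omega)
  simpa only [rowWord, pow_zero, mul_one, one_mul, mul_assoc, pow_succ',
    gen_pow_mul_gen_mul] using h

theorem bump_one_zero (a b c d : ℕ) :
    rowWord a (b + 1) c d * gen 0 = gen 1 * rowWord (a + 1) b c d := by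
  have h := bump_row (show (0 : Fin 4) < 1 by decide) (a := a) (b := 0) (c := 0) (d := 0) (a' := 0)
    (b' := b) (c' := c) (d' := d) (by simp only [mem_rowList]; omega)
    (by simp only [mem_rowList]; omega)
  simpa only [rowWord, pow_zero, mul_one, one_mul, mul_assoc, pow_succ',
    gen_pow_mul_gen_mul] using h

theorem bump_two_zero (a c d : ℕ) :
    rowWord a 0 (c + 1) d * gen 0 = gen 2 * rowWord (a + 1) 0 c d := by
  have h := bump_row (show (0 : Fin 4) < 2 by decide) (a := a) (b := 0) (c := 0) (d := 0) (a' := 0)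
    (b' := 0) (c' := c) (d' := d) (by simp only [mem_rowList]; omega)
    (by simp only [mem_rowList]; omega)
  simpa only [rowWord, pow_zero, mul_one, one_mul, mul_assoc, pow_succ',
    gen_pow_mul_gen_mul] using h

theorem bump_three_zero (a d : ℕ) :
    rowWord a 0 0 (d + 1) * gen 0 = gen 3 * rowWord (a + 1) 0 0 d := by
  have h := bump_row (show (0 : Fin 4) < 3 by decide) (a := a) (b := 0) (c := 0) (d := 0) (a' := 0)
    (b' := 0) (c' := 0) (d' := d) (by simp only [mem_rowList]; omega)
    (by simp only [mem_rowList]; omega)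
  simpa only [rowWord, pow_zero, mul_one, one_mul, mul_assoc, pow_succ',
    gen_pow_mul_gen_mul] using h

/-- A semistandard tableau with at most four rows. The number of letters `0`, `1`, `2`, `3` in the
row `r`, counted from the longest row, is `aᵣ`, `bᵣ`, `cᵣ`, `dᵣ`; the row `r` has no letter below
`r - 1`. The inequalities say that the columns increase strictly. -/
structure Tableau where
  a₁ : ℕ
  b₁ : ℕ
  c₁ : ℕ
  d₁ : ℕ
  b₂ : ℕ
  c₂ : ℕ
  d₂ : ℕ
  c₃ : ℕ
  d₃ : ℕ
  d₄ : ℕ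
  h₁ : b₂ ≤ a₁
  h₂ : b₂ + c₂ ≤ a₁ + b₁
  h₃ : b₂ + c₂ + d₂ ≤ a₁ + b₁ + c₁
  h₄ : c₃ ≤ b₂
  h₅ : c₃ + d₃ ≤ b₂ + c₂
  h₆ : d₄ ≤ c₃

/-- The row reading of a tableau, beginning with the shortest row. -/
def Tableau.reading (t : Tableau) : PlacticMonoid 4 :=
  rowWord 0 0 0 t.d₄ * rowWord 0 0 t.c₃ t.d₃ * rowWord 0 t.b₂ t.c₂ t.d₂ *
    rowWord t.a₁ t.b₁ t.c₁ t.d₁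

/-- The letter `x` is appended to the row `q`, and the insertion ends. -/
theorem mul_mul_of_append {M : Type*} [Monoid M] {q x q' : M} (p : M) (h : q * x = q') :
    p * q * x = p * q' := by
  rw [mul_assoc, h]

/-- The letter `x` bumps the letter `y` from the row `q`, and `y` is inserted into the rows `p`
above it. -/
theorem mul_mul_of_bump {M : Type*} [Monoid M] {p q x y q' r : M} (h : q * x = y * q')
    (h' : p * y = r) : p * q * x = r * q' := by
  rw [mul_assoc, h, ← mul_assoc, h']

/-- Row insertion of a letter into a tableau gives a tableau. -/
theorem Tableau.exists_reading_mul_gen (t : Tableau) (x : Fin 4) :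
    ∃ t' : Tableau, t.reading * gen x = t'.reading := by
  obtain ⟨a₁, b₁, c₁, d₁, b₂, c₂, d₂, c₃, d₃, d₄, h₁, h₂, h₃, h₄, h₅, h₆⟩ := t
  fin_cases x
  · rcases b₁ with _ | b₁
    · rcases c₁ with _ | c₁
      · rcases d₁ with _ | d₁
        · exact ⟨⟨a₁ + 1, 0, 0, 0, b₂, c₂, d₂, c₃, d₃, d₄, by omega, by omega, by omega, by omega,
            by omega, by omega⟩, mul_mul_of_append _ (insert_zero _)⟩
        · exact ⟨⟨a₁ + 1, 0, 0, d₁, b₂, c₂, d₂ + 1, c₃, d₃, d₄, by omega, by omega, by omega,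
            by omega, by omega, by omega⟩,
            mul_mul_of_bump (bump_three_zero _ _) (mul_mul_of_append _ (insert_three _ _ _ _))⟩
      · rcases d₂ with _ | d₂
        · exact ⟨⟨a₁ + 1, 0, c₁, d₁, b₂, c₂ + 1, 0, c₃, d₃, d₄, by omega, by omega, by omega,
            by omega, by omega, by omega⟩,
            mul_mul_of_bump (bump_two_zero _ _ _) (mul_mul_of_append _ (insert_two _ _ _))⟩
        · exact ⟨⟨a₁ + 1, 0, c₁, d₁, b₂, c₂ + 1, d₂, c₃, d₃ + 1, d₄, by omega, by omega, by omega,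
            by omega, by omega, by omega⟩,
            mul_mul_of_bump (bump_two_zero _ _ _) (mul_mul_of_bump (bump_three_two _ _ _ _)
              (mul_mul_of_append _ (insert_three _ _ _ _)))⟩
    · rcases c₂ with _ | c₂
      · rcases d₂ with _ | d₂
        · exact ⟨⟨a₁ + 1, b₁, c₁, d₁, b₂ + 1, 0, 0, c₃, d₃, d₄, by omega, by omega, by omega,
            by omega, by omega, by omega⟩,
            mul_mul_of_bump (bump_one_zero _ _ _ _) (mul_mul_of_append _ (insert_one _ _))⟩
        · exact ⟨⟨a₁ + 1, b₁, c₁, d₁, b₂ + 1, 0, d₂, c₃, d₃ + 1, d₄, by omega, by omega, by omega,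
            by omega, by omega, by omega⟩,
            mul_mul_of_bump (bump_one_zero _ _ _ _) (mul_mul_of_bump (bump_three_one _ _ _)
              (mul_mul_of_append _ (insert_three _ _ _ _)))⟩
      · rcases d₃ with _ | d₃
        · exact ⟨⟨a₁ + 1, b₁, c₁, d₁, b₂ + 1, c₂, d₂, c₃ + 1, 0, d₄, by omega, by omega, by omega,
            by omega, by omega, by omega⟩,
            mul_mul_of_bump (bump_one_zero _ _ _ _) (mul_mul_of_bump (bump_two_one _ _ _ _)
              (mul_mul_of_append _ (insert_two _ _ _)))⟩
        · exact ⟨⟨a₁ + 1, b₁, c₁, d₁, b₂ + 1, c₂, d₂, c₃ + 1, d₃, d₄ + 1, by omega, by omega,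
            by omega, by omega, by omega, by omega⟩,
            mul_mul_of_bump (bump_one_zero _ _ _ _) (mul_mul_of_bump (bump_two_one _ _ _ _)
              (mul_mul_of_bump (bump_three_two _ _ _ _) (insert_three _ _ _ _)))⟩
  · rcases c₁ with _ | c₁
    · rcases d₁ with _ | d₁
      · exact ⟨⟨a₁, b₁ + 1, 0, 0, b₂, c₂, d₂, c₃, d₃, d₄, by omega, by omega, by omega, by omega,
          by omega, by omega⟩, mul_mul_of_append _ (insert_one _ _)⟩
      · exact ⟨⟨a₁, b₁ + 1, 0, d₁, b₂, c₂, d₂ + 1, c₃, d₃, d₄, by omega, by omega, by omega,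
          by omega, by omega, by omega⟩,
          mul_mul_of_bump (bump_three_one _ _ _) (mul_mul_of_append _ (insert_three _ _ _ _))⟩
    · rcases d₂ with _ | d₂
      · exact ⟨⟨a₁, b₁ + 1, c₁, d₁, b₂, c₂ + 1, 0, c₃, d₃, d₄, by omega, by omega, by omega,
          by omega, by omega, by omega⟩,
          mul_mul_of_bump (bump_two_one _ _ _ _) (mul_mul_of_append _ (insert_two _ _ _))⟩
      · exact ⟨⟨a₁, b₁ + 1, c₁, d₁, b₂, c₂ + 1, d₂, c₃, d₃ + 1, d₄, by omega, by omega, by omega,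
          by omega, by omega, by omega⟩,
          mul_mul_of_bump (bump_two_one _ _ _ _) (mul_mul_of_bump (bump_three_two _ _ _ _)
            (mul_mul_of_append _ (insert_three _ _ _ _)))⟩
  · rcases d₁ with _ | d₁
    · exact ⟨⟨a₁, b₁, c₁ + 1, 0, b₂, c₂, d₂, c₃, d₃, d₄, by omega, by omega, by omega, by omega,
        by omega, by omega⟩, mul_mul_of_append _ (insert_two _ _ _)⟩
    · exact ⟨⟨a₁, b₁, c₁ + 1, d₁, b₂, c₂, d₂ + 1, c₃, d₃, d₄, by omega, by omega, by omega,
        by omega, by omega, by omega⟩,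
        mul_mul_of_bump (bump_three_two _ _ _ _) (mul_mul_of_append _ (insert_three _ _ _ _))⟩
  · exact ⟨⟨a₁, b₁, c₁, d₁ + 1, b₂, c₂, d₂, c₃, d₃, d₄, by omega, by omega, by omega, by omega,
      by omega, by omega⟩, mul_mul_of_append _ (insert_three _ _ _ _)⟩

/-- Each element of the plactic monoid is the reading of a tableau. -/
theorem exists_tableau (w : PlacticMonoid 4) : ∃ t : Tableau, w = t.reading := by
  induction w using plactic_induction with
  | one =>
    exact ⟨⟨0, 0, 0, 0, 0, 0, 0, 0, 0, 0, le_rfl, le_rfl, le_rfl, le_rfl, le_rfl, le_rfl⟩, by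
      simp [Tableau.reading, rowWord]⟩
  | mul_gen w x ih =>
    obtain ⟨t, rfl⟩ := ih
    exact t.exists_reading_mul_gen x

/-! ### The action of the generators on increasing integer vectors -/

/-- The natural number `n` as an element of `MaxPlus`. -/
def nat (n : ℕ) : MaxPlus := fin n

theorem nat_zero : nat 0 = 1 := by rw [nat, Nat.cast_zero, fin_zero]

theorem nat_mul (m n : ℕ) : nat m * nat n = nat (m + n) := by
  rw [nat, nat, nat, fin_mul, Nat.cast_add]

theorem nat_add (m n : ℕ) : nat m + nat n = nat (max m n) := by
  rw [nat, nat, nat, fin_add, Nat.cast_max]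

theorem nat_inj {m n : ℕ} : nat m = nat n ↔ m = n := by rw [nat, nat, fin_inj, Nat.cast_inj]

/-- The vector over `MaxPlus` with the natural numbers `f i` as entries. -/
def vec {k : ℕ} (f : Fin k → ℕ) : Fin k → MaxPlus := fun i => nat (f i)

theorem pairRep_gen_zero : pairRep (gen 0) =
    !![nat 1, nat 1, nat 1, nat 1, nat 1, nat 1;
       0, nat 1, nat 1, nat 1, nat 1, nat 1;
       0, 0, nat 1, 0, nat 1, nat 1;
       0, 0, 0, nat 0, nat 0, nat 0;
       0, 0, 0, 0, nat 0, nat 0;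
       0, 0, 0, 0, 0, nat 0] := by
  ext i j; fin_cases i <;> fin_cases j <;> rfl

/-- The action of a power of a letter on an increasing vector. Among the entries that are
increased by the same amount on the way to a given coordinate, the largest one gives the maximum.
-/
theorem vec_pairRep_zero (g₀ g₁ g₂ g₃ g₄ g₅ n : ℕ) (h₀ : g₀ ≤ g₁) (h₁ : g₁ ≤ g₂) (h₁' : g₁ ≤ g₃)
    (h₂ : g₂ ≤ g₄) (h₃ : g₃ ≤ g₄) (h₄ : g₄ ≤ g₅) :
    vec ![g₀, g₁, g₂, g₃, g₄, g₅] ᵥ* pairRep (gen 0 ^ n) =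
      vec ![g₀ + n, g₁ + n, g₂ + n, max g₃ (g₁ + n), max g₄ (g₂ + n), max g₅ (g₂ + n)] := by
  induction n with
  | zero =>
    rw [pow_zero, map_one, vecMul_one]
    congr 1; simp; omega
  | succ n ih =>
    rw [pow_succ, map_mul, ← vecMul_vecMul, ih, pairRep_gen_zero]
    funext j
    fin_cases j <;>
      simp only [vec, Matrix.vecMul, dotProduct, Fin.sum_univ_six, of_apply, cons_val,
        Fin.reduceFinMk,
        Fin.zero_eta, Fin.isValue, Fin.mk_one, mul_zero, add_zero, nat_mul, nat_add,
        nat_inj] <;> omega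

theorem pairRep_gen_one : pairRep (gen 1) =
    !![nat 1, nat 1, nat 1, nat 1, nat 1, nat 1;
       0, nat 0, nat 0, nat 1, nat 1, nat 1;
       0, 0, nat 0, 0, nat 1, nat 1;
       0, 0, 0, nat 1, nat 1, nat 1;
       0, 0, 0, 0, nat 1, nat 1;
       0, 0, 0, 0, 0, nat 0] := by
  ext i j; fin_cases i <;> fin_cases j <;> rfl

theorem vec_pairRep_one (g₀ g₁ g₂ g₃ g₄ g₅ n : ℕ) (h₀ : g₀ ≤ g₁) (h₁ : g₁ ≤ g₂) (h₁' : g₁ ≤ g₃)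
    (h₂ : g₂ ≤ g₄) (h₃ : g₃ ≤ g₄) (h₄ : g₄ ≤ g₅) :
    vec ![g₀, g₁, g₂, g₃, g₄, g₅] ᵥ* pairRep (gen 1 ^ n) =
      vec ![g₀ + n, max g₁ (g₀ + n), max g₂ (g₀ + n), g₃ + n, g₄ + n, max g₅ (g₄ + n)] := by
  induction n with
  | zero =>
    rw [pow_zero, map_one, vecMul_one]
    congr 1; simp; omega
  | succ n ih =>
    rw [pow_succ, map_mul, ← vecMul_vecMul, ih, pairRep_gen_one]
    funext j
    fin_cases j <;>
      simp only [vec, Matrix.vecMul, dotProduct, Fin.sum_univ_six, of_apply, cons_val,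
        Fin.reduceFinMk,
        Fin.zero_eta, Fin.isValue, Fin.mk_one, mul_zero, add_zero, nat_mul, nat_add,
        nat_inj] <;> omega

theorem pairRep_gen_two : pairRep (gen 2) =
    !![nat 0, nat 1, nat 1, nat 1, nat 1, nat 1;
       0, nat 1, nat 1, nat 1, nat 1, nat 1;
       0, 0, nat 0, 0, nat 0, nat 1;
       0, 0, 0, nat 1, nat 1, nat 1;
       0, 0, 0, 0, nat 0, nat 1;
       0, 0, 0, 0, 0, nat 1] := by
  ext i j; fin_cases i <;> fin_cases j <;> rfl

theorem vec_pairRep_two (g₀ g₁ g₂ g₃ g₄ g₅ n : ℕ) (h₀ : g₀ ≤ g₁) (h₁ : g₁ ≤ g₂) (h₁' : g₁ ≤ g₃)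
    (h₂ : g₂ ≤ g₄) (h₃ : g₃ ≤ g₄) (h₄ : g₄ ≤ g₅) :
    vec ![g₀, g₁, g₂, g₃, g₄, g₅] ᵥ* pairRep (gen 2 ^ n) =
      vec ![g₀, g₁ + n, max g₂ (g₁ + n), g₃ + n, max g₄ (g₃ + n), g₅ + n] := by
  induction n with
  | zero =>
    rw [pow_zero, map_one, vecMul_one]
    congr 1; simp; omega
  | succ n ih =>
    rw [pow_succ, map_mul, ← vecMul_vecMul, ih, pairRep_gen_two]
    funext j
    fin_cases j <;>
      simp only [vec, Matrix.vecMul, dotProduct, Fin.sum_univ_six, of_apply, cons_val,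
        Fin.reduceFinMk,
        Fin.zero_eta, Fin.isValue, Fin.mk_one, mul_zero, add_zero, nat_mul, nat_add,
        nat_inj] <;> omega

theorem pairRep_gen_three : pairRep (gen 3) =
    !![nat 0, nat 0, nat 1, nat 0, nat 1, nat 1;
       0, nat 0, nat 1, nat 0, nat 1, nat 1;
       0, 0, nat 1, 0, nat 1, nat 1;
       0, 0, 0, nat 0, nat 1, nat 1;
       0, 0, 0, 0, nat 1, nat 1;
       0, 0, 0, 0, 0, nat 1] := by
  ext i j; fin_cases i <;> fin_cases j <;> rfl

theorem vec_pairRep_three (g₀ g₁ g₂ g₃ g₄ g₅ n : ℕ) (h₀ : g₀ ≤ g₁) (h₁ : g₁ ≤ g₂) (h₁' : g₁ ≤ g₃)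
    (h₂ : g₂ ≤ g₄) (h₃ : g₃ ≤ g₄) (h₄ : g₄ ≤ g₅) :
    vec ![g₀, g₁, g₂, g₃, g₄, g₅] ᵥ* pairRep (gen 3 ^ n) =
      vec ![g₀, g₁, g₂ + n, g₃, g₄ + n, g₅ + n] := by
  induction n with
  | zero =>
    rw [pow_zero, map_one, vecMul_one]
    congr 1
  | succ n ih =>
    rw [pow_succ, map_mul, ← vecMul_vecMul, ih, pairRep_gen_three]
    funext j
    fin_cases j <;>
      simp only [vec, Matrix.vecMul, dotProduct, Fin.sum_univ_six, of_apply, cons_val,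
        Fin.reduceFinMk,
        Fin.zero_eta, Fin.isValue, Fin.mk_one, mul_zero, add_zero, nat_mul, nat_add,
        nat_inj] <;> omega

theorem rowRep_gen_zero : rowRep (gen 0) =
    !![nat 1, nat 1, nat 1, nat 1, nat 1;
       0, nat 0, nat 0, nat 0, nat 0;
       0, 0, nat 0, nat 0, nat 0;
       0, 0, 0, nat 0, nat 0;
       0, 0, 0, 0, nat 0] := by
  ext i j; fin_cases i <;> fin_cases j <;> rfl

theorem vec_rowRep_zero (f₀ f₁ f₂ f₃ f₄ n : ℕ) (h₀ : f₀ ≤ f₁) (h₁ : f₁ ≤ f₂) (h₂ : f₂ ≤ f₃)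
    (h₃ : f₃ ≤ f₄) :
    vec ![f₀, f₁, f₂, f₃, f₄] ᵥ* rowRep (gen 0 ^ n) =
      vec ![f₀ + n, max f₁ (f₀ + n), max f₂ (f₀ + n), max f₃ (f₀ + n), max f₄ (f₀ + n)] := by
  induction n with
  | zero =>
    rw [pow_zero, map_one, vecMul_one]
    congr 1; simp; omega
  | succ n ih =>
    rw [pow_succ, map_mul, ← vecMul_vecMul, ih, rowRep_gen_zero]
    funext j
    fin_cases j <;>
      simp only [vec, Matrix.vecMul, dotProduct, Fin.sum_univ_five, of_apply, cons_val,
        Fin.reduceFinMk,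
        Fin.zero_eta, Fin.isValue, Fin.mk_one, mul_zero, add_zero, nat_mul, nat_add,
        nat_inj] <;> omega

theorem rowRep_gen_one : rowRep (gen 1) =
    !![nat 0, nat 1, nat 1, nat 1, nat 1;
       0, nat 1, nat 1, nat 1, nat 1;
       0, 0, nat 0, nat 0, nat 0;
       0, 0, 0, nat 0, nat 0;
       0, 0, 0, 0, nat 0] := by
  ext i j; fin_cases i <;> fin_cases j <;> rfl

theorem vec_rowRep_one (f₀ f₁ f₂ f₃ f₄ n : ℕ) (h₀ : f₀ ≤ f₁) (h₁ : f₁ ≤ f₂) (h₂ : f₂ ≤ f₃)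
    (h₃ : f₃ ≤ f₄) :
    vec ![f₀, f₁, f₂, f₃, f₄] ᵥ* rowRep (gen 1 ^ n) =
      vec ![f₀, f₁ + n, max f₂ (f₁ + n), max f₃ (f₁ + n), max f₄ (f₁ + n)] := by
  induction n with
  | zero =>
    rw [pow_zero, map_one, vecMul_one]
    congr 1; simp; omega
  | succ n ih =>
    rw [pow_succ, map_mul, ← vecMul_vecMul, ih, rowRep_gen_one]
    funext j
    fin_cases j <;>
      simp only [vec, Matrix.vecMul, dotProduct, Fin.sum_univ_five, of_apply, cons_val,
        Fin.reduceFinMk,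
        Fin.zero_eta, Fin.isValue, Fin.mk_one, mul_zero, add_zero, nat_mul, nat_add,
        nat_inj] <;> omega

theorem rowRep_gen_two : rowRep (gen 2) =
    !![nat 0, nat 0, nat 1, nat 1, nat 1;
       0, nat 0, nat 1, nat 1, nat 1;
       0, 0, nat 1, nat 1, nat 1;
       0, 0, 0, nat 0, nat 0;
       0, 0, 0, 0, nat 0] := by
  ext i j; fin_cases i <;> fin_cases j <;> rfl

theorem vec_rowRep_two (f₀ f₁ f₂ f₃ f₄ n : ℕ) (h₀ : f₀ ≤ f₁) (h₁ : f₁ ≤ f₂) (h₂ : f₂ ≤ f₃)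
    (h₃ : f₃ ≤ f₄) :
    vec ![f₀, f₁, f₂, f₃, f₄] ᵥ* rowRep (gen 2 ^ n) =
      vec ![f₀, f₁, f₂ + n, max f₃ (f₂ + n), max f₄ (f₂ + n)] := by
  induction n with
  | zero =>
    rw [pow_zero, map_one, vecMul_one]
    congr 1; simp; omega
  | succ n ih =>
    rw [pow_succ, map_mul, ← vecMul_vecMul, ih, rowRep_gen_two]
    funext j
    fin_cases j <;>
      simp only [vec, Matrix.vecMul, dotProduct, Fin.sum_univ_five, of_apply, cons_val,
        Fin.reduceFinMk,
        Fin.zero_eta, Fin.isValue, Fin.mk_one, mul_zero, add_zero, nat_mul, nat_add,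
        nat_inj] <;> omega

theorem rowRep_gen_three : rowRep (gen 3) =
    !![nat 0, nat 0, nat 0, nat 1, nat 1;
       0, nat 0, nat 0, nat 1, nat 1;
       0, 0, nat 0, nat 1, nat 1;
       0, 0, 0, nat 1, nat 1;
       0, 0, 0, 0, nat 0] := by
  ext i j; fin_cases i <;> fin_cases j <;> rfl

theorem vec_rowRep_three (f₀ f₁ f₂ f₃ f₄ n : ℕ) (h₀ : f₀ ≤ f₁) (h₁ : f₁ ≤ f₂) (h₂ : f₂ ≤ f₃)
    (h₃ : f₃ ≤ f₄) :
    vec ![f₀, f₁, f₂, f₃, f₄] ᵥ* rowRep (gen 3 ^ n) =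
      vec ![f₀, f₁, f₂, f₃ + n, max f₄ (f₃ + n)] := by
  induction n with
  | zero =>
    rw [pow_zero, map_one, vecMul_one]
    congr 1; simp; omega
  | succ n ih =>
    rw [pow_succ, map_mul, ← vecMul_vecMul, ih, rowRep_gen_three]
    funext j
    fin_cases j <;>
      simp only [vec, Matrix.vecMul, dotProduct, Fin.sum_univ_five, of_apply, cons_val,
        Fin.reduceFinMk,
        Fin.zero_eta, Fin.isValue, Fin.mk_one, mul_zero, add_zero, nat_mul, nat_add,
        nat_inj] <;> omega

theorem colRep_gen_zero : colRep (gen 0) =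
    !![nat 1, nat 1, nat 1, nat 1, nat 1;
       0, nat 1, nat 1, nat 1, nat 1;
       0, 0, nat 1, nat 1, nat 1;
       0, 0, 0, nat 0, nat 1;
       0, 0, 0, 0, nat 1] := by
  ext i j; fin_cases i <;> fin_cases j <;> rfl

theorem vec_colRep_zero (f₀ f₁ f₂ f₃ f₄ n : ℕ) (h₀ : f₀ ≤ f₁) (h₁ : f₁ ≤ f₂) (h₂ : f₂ ≤ f₃)
    (h₃ : f₃ ≤ f₄) :
    vec ![f₀, f₁, f₂, f₃, f₄] ᵥ* colRep (gen 0 ^ n) =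
      vec ![f₀ + n, f₁ + n, f₂ + n, max f₃ (f₂ + n), f₄ + n] := by
  induction n with
  | zero =>
    rw [pow_zero, map_one, vecMul_one]
    congr 1; simp; omega
  | succ n ih =>
    rw [pow_succ, map_mul, ← vecMul_vecMul, ih, colRep_gen_zero]
    funext j
    fin_cases j <;>
      simp only [vec, Matrix.vecMul, dotProduct, Fin.sum_univ_five, of_apply, cons_val,
        Fin.reduceFinMk,
        Fin.zero_eta, Fin.isValue, Fin.mk_one, mul_zero, add_zero, nat_mul, nat_add,
        nat_inj] <;> omega

theorem colRep_gen_one : colRep (gen 1) =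
    !![nat 1, nat 1, nat 1, nat 1, nat 1;
       0, nat 1, nat 1, nat 1, nat 1;
       0, 0, nat 0, nat 1, nat 1;
       0, 0, 0, nat 1, nat 1;
       0, 0, 0, 0, nat 1] := by
  ext i j; fin_cases i <;> fin_cases j <;> rfl

theorem vec_colRep_one (f₀ f₁ f₂ f₃ f₄ n : ℕ) (h₀ : f₀ ≤ f₁) (h₁ : f₁ ≤ f₂) (h₂ : f₂ ≤ f₃)
    (h₃ : f₃ ≤ f₄) :
    vec ![f₀, f₁, f₂, f₃, f₄] ᵥ* colRep (gen 1 ^ n) =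
      vec ![f₀ + n, f₁ + n, max f₂ (f₁ + n), f₃ + n, f₄ + n] := by
  induction n with
  | zero =>
    rw [pow_zero, map_one, vecMul_one]
    congr 1; simp; omega
  | succ n ih =>
    rw [pow_succ, map_mul, ← vecMul_vecMul, ih, colRep_gen_one]
    funext j
    fin_cases j <;>
      simp only [vec, Matrix.vecMul, dotProduct, Fin.sum_univ_five, of_apply, cons_val,
        Fin.reduceFinMk,
        Fin.zero_eta, Fin.isValue, Fin.mk_one, mul_zero, add_zero, nat_mul, nat_add,
        nat_inj] <;> omega

theorem colRep_gen_two : colRep (gen 2) =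
    !![nat 1, nat 1, nat 1, nat 1, nat 1;
       0, nat 0, nat 1, nat 1, nat 1;
       0, 0, nat 1, nat 1, nat 1;
       0, 0, 0, nat 1, nat 1;
       0, 0, 0, 0, nat 1] := by
  ext i j; fin_cases i <;> fin_cases j <;> rfl

theorem vec_colRep_two (f₀ f₁ f₂ f₃ f₄ n : ℕ) (h₀ : f₀ ≤ f₁) (h₁ : f₁ ≤ f₂) (h₂ : f₂ ≤ f₃)
    (h₃ : f₃ ≤ f₄) :
    vec ![f₀, f₁, f₂, f₃, f₄] ᵥ* colRep (gen 2 ^ n) =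
      vec ![f₀ + n, max f₁ (f₀ + n), f₂ + n, f₃ + n, f₄ + n] := by
  induction n with
  | zero =>
    rw [pow_zero, map_one, vecMul_one]
    congr 1; simp; omega
  | succ n ih =>
    rw [pow_succ, map_mul, ← vecMul_vecMul, ih, colRep_gen_two]
    funext j
    fin_cases j <;>
      simp only [vec, Matrix.vecMul, dotProduct, Fin.sum_univ_five, of_apply, cons_val,
        Fin.reduceFinMk,
        Fin.zero_eta, Fin.isValue, Fin.mk_one, mul_zero, add_zero, nat_mul, nat_add,
        nat_inj] <;> omega

theorem colRep_gen_three : colRep (gen 3) =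
    !![nat 0, nat 1, nat 1, nat 1, nat 1;
       0, nat 1, nat 1, nat 1, nat 1;
       0, 0, nat 1, nat 1, nat 1;
       0, 0, 0, nat 1, nat 1;
       0, 0, 0, 0, nat 1] := by
  ext i j; fin_cases i <;> fin_cases j <;> rfl

theorem vec_colRep_three (f₀ f₁ f₂ f₃ f₄ n : ℕ) (h₀ : f₀ ≤ f₁) (h₁ : f₁ ≤ f₂) (h₂ : f₂ ≤ f₃)
    (h₃ : f₃ ≤ f₄) :
    vec ![f₀, f₁, f₂, f₃, f₄] ᵥ* colRep (gen 3 ^ n) =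
      vec ![f₀, f₁ + n, f₂ + n, f₃ + n, f₄ + n] := by
  induction n with
  | zero =>
    rw [pow_zero, map_one, vecMul_one]
    congr 1
  | succ n ih =>
    rw [pow_succ, map_mul, ← vecMul_vecMul, ih, colRep_gen_three]
    funext j
    fin_cases j <;>
      simp only [vec, Matrix.vecMul, dotProduct, Fin.sum_univ_five, of_apply, cons_val,
        Fin.reduceFinMk,
        Fin.zero_eta, Fin.isValue, Fin.mk_one, mul_zero, add_zero, nat_mul, nat_add,
        nat_inj] <;> omega

/-! ### The invariants determine the tableau -/

theorem one_eq_vec (k : ℕ) : (1 : Fin k → MaxPlus) = vec 0 := by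
  funext i; simp [vec, nat_zero]

theorem vec_row {k : ℕ} (ρ : PlacticMonoid 4 →* Matrix (Fin k) (Fin k) MaxPlus)
    (v : Fin k → MaxPlus)
    (a b c d : ℕ) : v ᵥ* ρ (rowWord a b c d) =
      v ᵥ* ρ (gen 0 ^ a) ᵥ* ρ (gen 1 ^ b) ᵥ* ρ (gen 2 ^ c) ᵥ* ρ (gen 3 ^ d) := by
  simp only [rowWord, map_mul, vecMul_vecMul]

theorem vec_reading {k : ℕ} (ρ : PlacticMonoid 4 →* Matrix (Fin k) (Fin k) MaxPlus)
    (v : Fin k → MaxPlus) (t : Tableau) : v ᵥ* ρ t.reading =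
      v ᵥ* ρ (rowWord 0 0 0 t.d₄) ᵥ* ρ (rowWord 0 0 t.c₃ t.d₃) ᵥ* ρ (rowWord 0 t.b₂ t.c₂ t.d₂) ᵥ*
        ρ (rowWord t.a₁ t.b₁ t.c₁ t.d₁) := by
  simp only [Tableau.reading, map_mul, vecMul_vecMul]

theorem zero_six : (0 : Fin 6 → ℕ) = ![0, 0, 0, 0, 0, 0] := by decide

theorem zero_five : (0 : Fin 5 → ℕ) = ![0, 0, 0, 0, 0] := by decide

/-- The entry at `{1,2}` counts the letters `≤ 2` in the first two rows, and the entry at `{2,3}`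
counts all letters in these rows. -/
theorem pairRep_reading (t : Tableau) :
    ((1 : Fin 6 → MaxPlus) ᵥ* pairRep t.reading) 3 = nat (t.a₁ + t.b₁ + t.c₁ + t.b₂ + t.c₂) ∧
    ((1 : Fin 6 → MaxPlus) ᵥ* pairRep t.reading) 5 =
      nat (t.a₁ + t.b₁ + t.c₁ + t.d₁ + t.b₂ + t.c₂ + t.d₂) := by
  obtain ⟨a₁, b₁, c₁, d₁, b₂, c₂, d₂, c₃, d₃, d₄, h₁, h₂, h₃, h₄, h₅, h₆⟩ := t
  rw [vec_reading, one_eq_vec, zero_six, vec_row, vec_row, vec_row, vec_row]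
  simp only [pow_zero, map_one, vecMul_one]
  rw [vec_pairRep_three _ _ _ _ _ _ _ (by omega) (by omega) (by omega) (by omega) (by omega)
    (by omega),
    vec_pairRep_two _ _ _ _ _ _ _ (by omega) (by omega) (by omega) (by omega) (by omega) (by omega),
    vec_pairRep_three _ _ _ _ _ _ _ (by omega) (by omega) (by omega) (by omega) (by omega)
      (by omega),
    vec_pairRep_one _ _ _ _ _ _ _ (by omega) (by omega) (by omega) (by omega) (by omega) (by omega),
    vec_pairRep_two _ _ _ _ _ _ _ (by omega) (by omega) (by omega) (by omega) (by omega) (by omega),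
    vec_pairRep_three _ _ _ _ _ _ _ (by omega) (by omega) (by omega) (by omega) (by omega)
      (by omega),
    vec_pairRep_zero _ _ _ _ _ _ _ (by omega) (by omega) (by omega) (by omega) (by omega)
      (by omega),
    vec_pairRep_one _ _ _ _ _ _ _ (by omega) (by omega) (by omega) (by omega) (by omega) (by omega),
    vec_pairRep_two _ _ _ _ _ _ _ (by omega) (by omega) (by omega) (by omega) (by omega) (by omega),
    vec_pairRep_three _ _ _ _ _ _ _ (by omega) (by omega) (by omega) (by omega) (by omega)
      (by omega)]
  constructor <;> simp only [vec, nat_inj, cons_val] <;> omega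

/-- The entry at `x` counts the letters `≤ x` in the first row. -/
theorem rowRep_reading (t : Tableau) :
    ((1 : Fin 5 → MaxPlus) ᵥ* rowRep t.reading) 0 = nat t.a₁ ∧
    ((1 : Fin 5 → MaxPlus) ᵥ* rowRep t.reading) 1 = nat (t.a₁ + t.b₁) ∧
    ((1 : Fin 5 → MaxPlus) ᵥ* rowRep t.reading) 2 = nat (t.a₁ + t.b₁ + t.c₁) ∧
    ((1 : Fin 5 → MaxPlus) ᵥ* rowRep t.reading) 3 = nat (t.a₁ + t.b₁ + t.c₁ + t.d₁) := by
  obtain ⟨a₁, b₁, c₁, d₁, b₂, c₂, d₂, c₃, d₃, d₄, h₁, h₂, h₃, h₄, h₅, h₆⟩ := t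
  rw [vec_reading, one_eq_vec, zero_five, vec_row, vec_row, vec_row, vec_row]
  simp only [pow_zero, map_one, vecMul_one]
  rw [vec_rowRep_three _ _ _ _ _ _ (by omega) (by omega) (by omega) (by omega),
    vec_rowRep_two _ _ _ _ _ _ (by omega) (by omega) (by omega) (by omega),
    vec_rowRep_three _ _ _ _ _ _ (by omega) (by omega) (by omega) (by omega),
    vec_rowRep_one _ _ _ _ _ _ (by omega) (by omega) (by omega) (by omega),
    vec_rowRep_two _ _ _ _ _ _ (by omega) (by omega) (by omega) (by omega),
    vec_rowRep_three _ _ _ _ _ _ (by omega) (by omega) (by omega) (by omega),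
    vec_rowRep_zero _ _ _ _ _ _ (by omega) (by omega) (by omega) (by omega),
    vec_rowRep_one _ _ _ _ _ _ (by omega) (by omega) (by omega) (by omega),
    vec_rowRep_two _ _ _ _ _ _ (by omega) (by omega) (by omega) (by omega),
    vec_rowRep_three _ _ _ _ _ _ (by omega) (by omega) (by omega) (by omega)]
  refine ⟨?_, ?_, ?_, ?_⟩ <;> simp only [vec, nat_inj, cons_val] <;> omega

/-- The entry at `{1,2,3}` counts all letters in the first three rows. -/
theorem colRep_reading (t : Tableau) :
    ((1 : Fin 5 → MaxPlus) ᵥ* colRep t.reading) 3 =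
      nat (t.a₁ + t.b₁ + t.c₁ + t.d₁ + t.b₂ + t.c₂ + t.d₂ + t.c₃ + t.d₃) := by
  obtain ⟨a₁, b₁, c₁, d₁, b₂, c₂, d₂, c₃, d₃, d₄, h₁, h₂, h₃, h₄, h₅, h₆⟩ := t
  rw [vec_reading, one_eq_vec, zero_five, vec_row, vec_row, vec_row, vec_row]
  simp only [pow_zero, map_one, vecMul_one]
  rw [vec_colRep_three _ _ _ _ _ _ (by omega) (by omega) (by omega) (by omega),
    vec_colRep_two _ _ _ _ _ _ (by omega) (by omega) (by omega) (by omega),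
    vec_colRep_three _ _ _ _ _ _ (by omega) (by omega) (by omega) (by omega),
    vec_colRep_one _ _ _ _ _ _ (by omega) (by omega) (by omega) (by omega),
    vec_colRep_two _ _ _ _ _ _ (by omega) (by omega) (by omega) (by omega),
    vec_colRep_three _ _ _ _ _ _ (by omega) (by omega) (by omega) (by omega),
    vec_colRep_zero _ _ _ _ _ _ (by omega) (by omega) (by omega) (by omega),
    vec_colRep_one _ _ _ _ _ _ (by omega) (by omega) (by omega) (by omega),
    vec_colRep_two _ _ _ _ _ _ (by omega) (by omega) (by omega) (by omega),
    vec_colRep_three _ _ _ _ _ _ (by omega) (by omega) (by omega) (by omega)]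
  simp only [vec, nat_inj, cons_val]; omega

theorem count_gen_pow (i x : Fin 4) (n : ℕ) :
    count i (gen x) ^ n = nat (if x = i then n else 0) := by
  rw [count_gen]
  split_ifs
  · induction n with
    | zero => rw [pow_zero, nat_zero]
    | succ n ih => rw [pow_succ, ih, nat, fin_mul, nat, Nat.cast_succ]
  · rw [one_pow, nat_zero]

theorem count_rowWord (a b c d : ℕ) (i : Fin 4) :
    count i (rowWord a b c d) = nat (![a, b, c, d] i) := by
  simp only [rowWord, map_mul, map_pow, count_gen_pow, nat_mul]
  fin_cases i <;> simp

theorem count_reading (t : Tableau) (i : Fin 4) : count i t.reading =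
    nat (![0, 0, 0, t.d₄] i + ![0, 0, t.c₃, t.d₃] i + ![0, t.b₂, t.c₂, t.d₂] i +
      ![t.a₁, t.b₁, t.c₁, t.d₁] i) := by
  simp only [Tableau.reading, map_mul, count_rowWord, nat_mul]

/-- The three representations and the content are jointly faithful. -/
theorem SameInvariants.eq {p q : PlacticMonoid 4} (h : SameInvariants p q) : p = q := by
  obtain ⟨t, rfl⟩ := exists_tableau p
  obtain ⟨t', rfl⟩ := exists_tableau q
  have hc : ∀ i, _ := fun i =>
    nat_inj.1 ((count_reading t i).symm.trans ((h.count i).trans (count_reading t' i)))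
  have c₁ := hc 1
  have c₂ := hc 2
  have c₃ := hc 3
  have r₀ := nat_inj.1 ((rowRep_reading t).1.symm.trans
    ((h.row 0 (by decide)).trans (rowRep_reading t').1))
  have r₁ := nat_inj.1 ((rowRep_reading t).2.1.symm.trans
    ((h.row 1 (by decide)).trans (rowRep_reading t').2.1))
  have r₂ := nat_inj.1 ((rowRep_reading t).2.2.1.symm.trans
    ((h.row 2 (by decide)).trans (rowRep_reading t').2.2.1))
  have r₃ := nat_inj.1 ((rowRep_reading t).2.2.2.symm.trans
    ((h.row 3 (by decide)).trans (rowRep_reading t').2.2.2))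
  have p₃ := nat_inj.1 ((pairRep_reading t).1.symm.trans
    ((congrFun h.pair 3).trans (pairRep_reading t').1))
  have p₅ := nat_inj.1 ((pairRep_reading t).2.symm.trans
    ((congrFun h.pair 5).trans (pairRep_reading t').2))
  have e := nat_inj.1 ((colRep_reading t).symm.trans
    ((h.col 3 (by decide)).trans (colRep_reading t')))
  -- the invariants are linear in the entries of the tableaux
  clear hc h
  obtain ⟨a₁, b₁, c₁, d₁, b₂, c₂, d₂, c₃, d₃, d₄, h₁, h₂, h₃, h₄, h₅, h₆⟩ := t
  obtain ⟨a₁', b₁', c₁', d₁', b₂', c₂', d₂', c₃', d₃', d₄', h₁', h₂', h₃', h₄', h₅', h₆'⟩ := t'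
  simp only [cons_val] at *
  congr 2 <;> omega

/-! ### Upper triangular matrices that violate the identity -/

/-- The matrix assigned to the letter `a`. -/
def witnessX : Matrix (Fin 5) (Fin 5) NatMaxPlus :=
  !![nfin 1, nfin 0, 0, 0, 0;
    0, nfin 2, nfin 0, 0, 0;
    0, 0, nfin 0, nfin 2, 0;
    0, 0, 0, nfin 1, 0;
    0, 0, 0, 0, nfin 2]

/-- The matrix assigned to the letter `b`. -/
def witnessY : Matrix (Fin 5) (Fin 5) NatMaxPlus :=
  !![nfin 2, nfin 1, 0, 0, 0;
    0, nfin 0, 0, 0, 0;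
    0, 0, nfin 2, nfin 2, 0;
    0, 0, 0, nfin 1, nfin 1;
    0, 0, 0, 0, nfin 1]

/-- The product `witnessX * witnessY`, the value of the word `ab`. -/
def witnessA : Matrix (Fin 5) (Fin 5) NatMaxPlus :=
  !![nfin 3, nfin 2, 0, 0, 0;
    0, nfin 2, nfin 2, nfin 2, 0;
    0, 0, nfin 2, nfin 3, nfin 3;
    0, 0, 0, nfin 2, nfin 2;
    0, 0, 0, 0, nfin 3]

/-- The product `witnessY * witnessX`, the value of the word `ba`. -/
def witnessB : Matrix (Fin 5) (Fin 5) NatMaxPlus :=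
  !![nfin 3, nfin 3, nfin 1, 0, 0;
    0, nfin 2, nfin 0, 0, 0;
    0, 0, nfin 2, nfin 4, 0;
    0, 0, 0, nfin 2, nfin 3;
    0, 0, 0, 0, nfin 3]

/-- The cube of `witnessA`. -/
def witnessA3 : Matrix (Fin 5) (Fin 5) NatMaxPlus :=
  !![nfin 9, nfin 8, nfin 7, nfin 7, nfin 7;
    0, nfin 6, nfin 6, nfin 7, nfin 8;
    0, 0, nfin 6, nfin 7, nfin 9;
    0, 0, 0, nfin 6, nfin 8;
    0, 0, 0, 0, nfin 9]

/-- The cube of `witnessB`. -/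
def witnessB3 : Matrix (Fin 5) (Fin 5) NatMaxPlus :=
  !![nfin 9, nfin 9, nfin 7, nfin 8, nfin 8;
    0, nfin 6, nfin 4, nfin 6, nfin 7;
    0, 0, nfin 6, nfin 8, nfin 10;
    0, 0, 0, nfin 6, nfin 9;
    0, 0, 0, 0, nfin 9]

/-- The value of `b a³ b³` at `witnessA` and `witnessB`. -/
def witnessWL : Matrix (Fin 5) (Fin 5) NatMaxPlus :=
  !![nfin 21, nfin 21, nfin 19, nfin 20, nfin 20;
    0, nfin 14, nfin 14, nfin 16, nfin 19;
    0, 0, nfin 14, nfin 16, nfin 21;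
    0, 0, 0, nfin 14, nfin 21;
    0, 0, 0, 0, nfin 21]

/-- The value of `b a³ b³ a b a` at `witnessA` and `witnessB`. -/
def witnessW : Matrix (Fin 5) (Fin 5) NatMaxPlus :=
  !![nfin 30, nfin 29, nfin 29, nfin 29, nfin 29;
    0, nfin 20, nfin 20, nfin 22, nfin 28;
    0, 0, nfin 20, nfin 22, nfin 30;
    0, 0, 0, nfin 20, nfin 30;
    0, 0, 0, 0, nfin 30]

/-- The value of `a b · b a³ b³ a b a`, the part of both words to the left of the middle letter.
-/
def witnessL : Matrix (Fin 5) (Fin 5) NatMaxPlus :=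
  !![nfin 36, nfin 35, nfin 35, nfin 35, nfin 35;
    0, nfin 24, nfin 24, nfin 26, nfin 36;
    0, 0, nfin 24, nfin 26, nfin 36;
    0, 0, 0, nfin 24, nfin 35;
    0, 0, 0, 0, nfin 36]

/-- The value of `b a³ b³ a b a · a b`, the part of both words to the right of the middle letter.
-/
def witnessR : Matrix (Fin 5) (Fin 5) NatMaxPlus :=
  !![nfin 36, nfin 36, nfin 34, nfin 35, nfin 35;
    0, nfin 24, nfin 24, nfin 26, nfin 34;
    0, 0, nfin 24, nfin 26, nfin 36;
    0, 0, 0, nfin 24, nfin 36;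
    0, 0, 0, 0, nfin 36]

theorem witnessX_mul_witnessY : witnessX * witnessY = witnessA := by decide +kernel

theorem witnessY_mul_witnessX : witnessY * witnessX = witnessB := by decide +kernel

theorem witness_cubeA : witnessA * witnessA * witnessA = witnessA3 := by decide +kernel

theorem witness_cubeB : witnessB * witnessB * witnessB = witnessB3 := by decide +kernel

theorem witness_prefix : witnessB * witnessA3 * witnessB3 = witnessWL := by decide +kernel

theorem witness_w : witnessWL * witnessA * witnessB * witnessA = witnessW := by decide +kernel

theorem witness_left : witnessA * witnessB * witnessW = witnessL := by decide +kernel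

theorem witness_right : witnessW * witnessA * witnessB = witnessR := by decide +kernel

theorem witness_middle : (witnessL * witnessB * witnessR) 0 4 = nfin 75 ∧
    (witnessL * witnessA * witnessR) 0 4 = nfin 74 := by decide +kernel

theorem map_eval {S T : Type*} [Semigroup S] [Semigroup T] (f : S →ₙ* T) (p : Word) (x y : S) :
    f (p.eval x y) = p.eval (f x) (f y) := by
  have : f.comp (FreeSemigroup.lift ![x, y]) = FreeSemigroup.lift ![f x, f y] := by
    refine FreeSemigroup.hom_ext ?_
    funext i
    fin_cases i <;> simp
  exact DFunLike.congr_fun this p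

theorem map_lhs {S : Type*} [Semigroup S] (φ : Word →ₙ* S) : φ Word.lhs =
    (Word.a * Word.b * Word.u * Word.a * Word.b).eval (φ Word.a * φ Word.b)
      (φ Word.b * φ Word.a) := by
  rw [Word.lhs, map_eval, map_mul, map_mul]

theorem map_rhs {S : Type*} [Semigroup S] (φ : Word →ₙ* S) : φ Word.rhs =
    (Word.a * Word.b * Word.v * Word.a * Word.b).eval (φ Word.a * φ Word.b)
      (φ Word.b * φ Word.a) := by
  rw [Word.rhs, map_eval, map_mul, map_mul]

theorem eval_mul {S : Type*} [Semigroup S] (p q : Word) (x y : S) :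
    (p * q).eval x y = p.eval x y * q.eval x y := map_mul _ _ _

theorem eval_a {S : Type*} [Semigroup S] (x y : S) : Word.a.eval x y = x := rfl

theorem eval_b {S : Type*} [Semigroup S] (x y : S) : Word.b.eval x y = y := rfl

theorem eval_w : Word.w.eval witnessA witnessB = witnessW := by
  rw [Word.w, ← witness_w, ← witness_prefix, ← witness_cubeA, ← witness_cubeB]
  simp only [eval_mul, eval_a, eval_b]

theorem eval_u : (Word.a * Word.b * Word.u * Word.a * Word.b).eval witnessA witnessB =
    witnessL * witnessB * witnessR := by
  rw [← witness_left, ← witness_right, ← eval_w]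
  simp only [Word.u, eval_mul, eval_a, eval_b, mul_assoc]

theorem eval_v : (Word.a * Word.b * Word.v * Word.a * Word.b).eval witnessA witnessB =
    witnessL * witnessA * witnessR := by
  rw [← witness_left, ← witness_right, ← eval_w]
  simp only [Word.v, eval_mul, eval_a, eval_b, mul_assoc]

theorem eval_lhs {S : Type*} [Semigroup S] (x y : S) : Word.lhs.eval x y =
    (Word.a * Word.b * Word.u * Word.a * Word.b).eval (x * y) (y * x) :=
  map_lhs (FreeSemigroup.lift ![x, y])

theorem eval_rhs {S : Type*} [Semigroup S] (x y : S) : Word.rhs.eval x y =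
    (Word.a * Word.b * Word.v * Word.a * Word.b).eval (x * y) (y * x) :=
  map_rhs (FreeSemigroup.lift ![x, y])

theorem witness_lhs : (Word.lhs.eval witnessX witnessY) 0 4 = nfin 75 := by
  rw [eval_lhs, witnessX_mul_witnessY, witnessY_mul_witnessX, eval_u]
  exact witness_middle.1

theorem witness_rhs : (Word.rhs.eval witnessX witnessY) 0 4 = nfin 74 := by
  rw [eval_rhs, witnessX_mul_witnessY, witnessY_mul_witnessX, eval_v]
  exact witness_middle.2

theorem upper_map {M : Matrix (Fin 5) (Fin 5) NatMaxPlus} (h : M.IsUpperTriangular) :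
    (ofNat.mapMatrix M).IsUpperTriangular := fun i j hij => by
  change ofNat (M i j) = 0
  rw [h hij, map_zero]

theorem upper_witness (x : Fin 2) : (![witnessX, witnessY] x).IsUpperTriangular := by
  intro i j hij
  fin_cases x <;> fin_cases i <;> fin_cases j <;> first | rfl | exact absurd hij (by decide)

theorem not_satisfiesIdentity_UT_five : ¬ SatisfiesIdentity (UT 5) Word.lhs Word.rhs := by
  intro h
  have h := lift_eq_of_satisfiesIdentity h (fun x => ofNat.mapMatrix (![witnessX, witnessY] x))
    fun x => upper_map (upper_witness x)
  have hlift : ∀ p : Word,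
      FreeSemigroup.lift (fun x => ofNat.mapMatrix (![witnessX, witnessY] x)) p =
        ofNat.mapMatrix (p.eval witnessX witnessY) := fun p => by
    have h := lift_comp (FreeSemigroup.lift ![witnessX, witnessY])
      ((RingHom.toMonoidHom ofNat.mapMatrix :
        Matrix (Fin 5) (Fin 5) NatMaxPlus →* Matrix (Fin 5) (Fin 5) MaxPlus) :
        Matrix (Fin 5) (Fin 5) NatMaxPlus →ₙ* Matrix (Fin 5) (Fin 5) MaxPlus) p
    simp only [FreeSemigroup.lift_of] at h
    exact h
  rw [hlift, hlift] at h
  have h := congrFun (congrFun h 0) 4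
  rw [RingHom.mapMatrix_apply, RingHom.mapMatrix_apply, Matrix.map_apply, Matrix.map_apply,
    witness_lhs, witness_rhs, ofNat_nfin, ofNat_nfin, fin_inj] at h
  norm_num at h

theorem satisfiesIdentity_plactic : SatisfiesIdentity (PlacticMonoid 4) Word.lhs Word.rhs := by
  intro φ
  rw [map_lhs, map_rhs]
  exact (sameInvariants_eval _ _).eq

theorem generatedVariety_plactic_subset :
    generatedVariety.{u} (PlacticMonoid 4) ⊆ generatedVariety.{u} (UT 5) :=
  fun _ hT X p q h => hT X p q fun φ => (sameInvariants_of_satisfiesIdentity h φ).eq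

theorem satisfiesIdentity_of_mulEquiv {S T : Type*} [Semigroup S] [Semigroup T] (e : S ≃* T)
    {X : Type*} {p q : FreeSemigroup X} (h : SatisfiesIdentity S p q) : SatisfiesIdentity T p q :=
      by
  intro φ
  have h := h ((e.symm : T →ₙ* S).comp φ)
  exact e.symm.injective h

end PlacticFour

theorem mainTheorem5 :
    SatisfiesIdentity (PlacticMonoid 4) Word.lhs Word.rhs ∧
      ¬ SatisfiesIdentity (UT 5) Word.lhs Word.rhs ∧
      generatedVariety.{u} (PlacticMonoid 4) ⊂ generatedVariety.{u} (UT 5) := by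
  refine ⟨PlacticFour.satisfiesIdentity_plactic, PlacticFour.not_satisfiesIdentity_UT_five,
    PlacticFour.generatedVariety_plactic_subset, fun h => ?_⟩
  -- `UT 5`, lifted to the universe in question, is in its own variety but not in the smaller one
  have hmem : Semigrp.of (ULift.{u} (UT 5)) ∈ generatedVariety.{u} (UT 5) :=
    fun X p q hpq => PlacticFour.satisfiesIdentity_of_mulEquiv MulEquiv.ulift.symm hpq
  exact PlacticFour.not_satisfiesIdentity_UT_five (PlacticFour.satisfiesIdentity_of_mulEquiv
    MulEquiv.ulift (h hmem (Fin 2) _ _ PlacticFour.satisfiesIdentity_plactic))
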